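/- Let $K$ be a field of positive characteristic $p$ and let $L$ be a Lie algebra over $K$ (of arbitrary dimension, not necessarily restricted), with lower central series $\gamma_1(L)=L$, $\gamma_{n+1}(L)=[\gamma_n(L),L]$. Let $S(L)$ be the symmetric algebra of $L$ with the Poisson bracket that extends the Lie bracket of $L$ by the Leibniz rule, and let $\mathbf{s}(L)=S(L)/(v^p\mid v\in L)$ be the truncated symmetric algebra with the induced Poisson bracket. For a Poisson algebra $R$ put $\gamma_1(R)=R$, $\gamma_{n+1}(R)=\{\gamma_n(R),R\}$ (linear span of brackets), and $R^{(0)}=R$, $R^{(n)}=\{R^{(n-1)},R\}\cdot R$ (ideal generated by brackets) for $n\ge 1$. For $s\ge1$, $R$ is Lie nilpotent of class $s$ if $\gamma_{s+1}(R)=0\neq\gamma_s(R)$, and strongly Lie nilpotent of class $s$ if $R^{(s)}=0\ne R^{(s-1)}$; $R$ is Lie nilpotent if some $\gamma_n(R)$ is zero. Theorem. (a) The Poisson dimension subalgebras are given, for all $n\ge 0$, by $$L\cap S(L)^{(n)}=\gamma_{n+1}(L),\qquad L\cap \mathbf{s}(L)^{(n)}=\gamma_{n+1}(L).$$ (b)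 Suppose that $\mathbf{s}(L)$ is Lie nilpotent. Then $\gamma_{n+1}(L)/\gamma_{n+2}(L)$ is finite dimensional for every $n\ge1$ and nonzero for only finitely many $n\ge 1$, and $\mathbf{s}(L)$ is strongly Lie nilpotent of class $$N=1+(p-1)\sum_{n\ge1}n\cdot\dim\bigl(\gamma_{n+1}(L)/\gamma_{n+2}(L)\bigr).$$ If moreover $p>3$, then $\mathbf{s}(L)$ is also Lie nilpotent of class $N$. Thus for $p>3$ the strong Lie nilpotency class, the Lie nilpotency class and $N$ are all equal, and for $p=2,3$ the strong Lie nilpotency class still equals $N$. -/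

import Mathlib

noncomputable section

/-- A Poisson algebra structure over `K` on a commutative unital associative `K`-algebra `A`:
a `K`-bilinear Lie bracket `{a, b}` that satisfies the Leibniz rule. -/
class PoissonAlgebra (K A : Type*) [CommRing K] [CommRing A] [Algebra K A] where
  /-- the Poisson bracket `{a, b}` -/
  bracket : A →ₗ[K] A →ₗ[K] A
  bracket_self : ∀ a, bracket a a = 0
  jacobi : ∀ a b c,
    bracket (bracket a b) c + bracket (bracket b c) a + bracket (bracket c a) b = 0
  leibniz : ∀ a b c, bracket (a * b) c = a * bracket b c + b * bracket a c

namespace PoissonAlgebra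

section Quotient

variable {K A : Type*} [CommRing K] [CommRing A] [Algebra K A]

theorem bracket_skew [PoissonAlgebra K A] (a b : A) :
    bracket (K := K) a b = -bracket (K := K) b a := by
  have h := bracket_self (K := K) (a + b)
  simp only [map_add, LinearMap.add_apply, bracket_self, zero_add, add_zero] at h
  rw [add_comm] at h
  exact eq_neg_of_add_eq_zero_left h

variable (I : Ideal A)

/-- The linear map on `A ⧸ I` induced by a linear map on `A` that vanishes on `I`. -/
def quotientLift {N : Type*} [AddCommGroup N] [Module K N] (f : A →ₗ[K] N)
    (hf : ∀ a ∈ I, f a = 0) : (A ⧸ I) →ₗ[K] N :=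
  Submodule.liftQ (I.restrictScalars K) f (fun a ha => hf a ha) ∘ₗ
    (Submodule.Quotient.restrictScalarsEquiv K I).symm.toLinearMap

theorem quotientLift_mk {N : Type*} [AddCommGroup N] [Module K N] (f : A →ₗ[K] N)
    (hf : ∀ a ∈ I, f a = 0) (a : A) : quotientLift I f hf (Ideal.Quotient.mk I a) = f a := rfl

variable [PoissonAlgebra K A]

/-- For `a ∈ A`, the map `b + I ↦ {a, b} + I`, where `I` is a Poisson ideal. -/
def quotientBracketAux (hI : ∀ a ∈ I, ∀ b : A, bracket (K := K) a b ∈ I) :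
    A →ₗ[K] (A ⧸ I) →ₗ[K] (A ⧸ I) where
  toFun a := quotientLift I ((Ideal.Quotient.mkₐ K I).toLinearMap ∘ₗ bracket (K := K) a)
    (fun b hb => Ideal.Quotient.eq_zero_iff_mem.2
      (by rw [bracket_skew]; exact neg_mem (hI b hb a)))
  map_add' a b := by
    refine LinearMap.ext fun x => ?_
    obtain ⟨x, rfl⟩ := Ideal.Quotient.mk_surjective x
    change Ideal.Quotient.mk I (bracket (K := K) (a + b) x) =
      Ideal.Quotient.mk I (bracket (K := K) a x) + Ideal.Quotient.mk I (bracket (K := K) b x)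
    rw [map_add, LinearMap.add_apply, map_add]
  map_smul' c a := by
    refine LinearMap.ext fun x => ?_
    obtain ⟨x, rfl⟩ := Ideal.Quotient.mk_surjective x
    change Ideal.Quotient.mkₐ K I (bracket (K := K) (c • a) x) =
      c • Ideal.Quotient.mkₐ K I (bracket (K := K) a x)
    rw [map_smul, LinearMap.smul_apply, map_smul]

/-- The bracket `{a + I, b + I} = {a, b} + I` on the quotient by a Poisson ideal `I`. -/
def quotientBracket (hI : ∀ a ∈ I, ∀ b : A, bracket (K := K) a b ∈ I) :
    (A ⧸ I) →ₗ[K] (A ⧸ I) →ₗ[K] (A ⧸ I) :=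
  quotientLift I (quotientBracketAux I hI) (by
    intro a ha
    refine LinearMap.ext fun x => ?_
    obtain ⟨x, rfl⟩ := Ideal.Quotient.mk_surjective x
    exact Ideal.Quotient.eq_zero_iff_mem.2 (hI a ha x))

theorem quotientBracket_mk_mk (hI : ∀ a ∈ I, ∀ b : A, bracket (K := K) a b ∈ I) (a b : A) :
    quotientBracket I hI (Ideal.Quotient.mk I a) (Ideal.Quotient.mk I b) =
      Ideal.Quotient.mk I (bracket (K := K) a b) := rfl

/-- The quotient of a Poisson algebra by a Poisson ideal. -/
abbrev quotient (hI : ∀ a ∈ I, ∀ b : A, bracket (K := K) a b ∈ I) : PoissonAlgebra K (A ⧸ I) where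
  bracket := quotientBracket I hI
  bracket_self a := by
    obtain ⟨a, rfl⟩ := Ideal.Quotient.mk_surjective a
    rw [quotientBracket_mk_mk, bracket_self, map_zero]
  jacobi a b c := by
    obtain ⟨a, rfl⟩ := Ideal.Quotient.mk_surjective a
    obtain ⟨b, rfl⟩ := Ideal.Quotient.mk_surjective b
    obtain ⟨c, rfl⟩ := Ideal.Quotient.mk_surjective c
    simp only [quotientBracket_mk_mk, ← map_add, jacobi, map_zero]
  leibniz a b c := by
    obtain ⟨a, rfl⟩ := Ideal.Quotient.mk_surjective a
    obtain ⟨b, rfl⟩ := Ideal.Quotient.mk_surjective b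
    obtain ⟨c, rfl⟩ := Ideal.Quotient.mk_surjective c
    simp only [← map_mul, quotientBracket_mk_mk, leibniz, map_add]

end Quotient

section Series

variable (K A : Type*) [CommRing K] [CommRing A] [Algebra K A] [PoissonAlgebra K A]

/-- The lower central series of a Poisson algebra as a Lie algebra, with shifted index:
`gamma K A n` is `γ_{n+1}(A)`, so `gamma K A 0 = A`, and `gamma K A (n + 1)` is the linear span of
all brackets `{a, b}` with `a ∈ gamma K A n` and `b ∈ A`. -/
def gamma : ℕ → Submodule K A
  | 0 => ⊤
  | n + 1 => Submodule.span K {z | ∃ a ∈ gamma n, ∃ b : A, z = bracket (K := K) a b}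

/-- The upper Lie powers: `A^{(0)} = A`, and `A^{(n+1)} = {A^{(n)}, A} · A` is the ideal generated
by all brackets `{a, b}` with `a ∈ A^{(n)}` and `b ∈ A`. -/
def upperPower : ℕ → Ideal A
  | 0 => ⊤
  | n + 1 => Ideal.span {z | ∃ a ∈ upperPower n, ∃ b : A, z = bracket (K := K) a b}

/-- `A` is Lie nilpotent of class `s`: `γ_{s+1}(A) = 0` and `γ_s(A) ≠ 0` (where `s ≥ 1`). -/
def IsLieNilpotentOfClass (s : ℕ) : Prop :=
  1 ≤ s ∧ gamma K A s = ⊥ ∧ gamma K A (s - 1) ≠ ⊥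

/-- `A` is strongly Lie nilpotent of class `s`: `A^{(s)} = 0` and `A^{(s-1)} ≠ 0`
(where `s ≥ 1`). -/
def IsStronglyLieNilpotentOfClass (s : ℕ) : Prop :=
  1 ≤ s ∧ upperPower K A s = ⊥ ∧ upperPower K A (s - 1) ≠ ⊥

/-- `A` is Lie nilpotent: some term of its lower central series vanishes. -/
def IsLieNilpotent : Prop := ∃ n, gamma K A n = ⊥

end Series

end PoissonAlgebra

namespace SymmetricAlgebra

section Derivation

variable {K M : Type*} [CommRing K] [AddCommGroup M] [Module K M]

/-- The algebra map `S(M) → S(M)[ε]`, `x ↦ x + ε f(x)` for `x ∈ M`. -/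
def derivAux (f : M →ₗ[K] SymmetricAlgebra K M) :
    SymmetricAlgebra K M →ₐ[K] TrivSqZeroExt (SymmetricAlgebra K M) (SymmetricAlgebra K M) :=
  lift ((TrivSqZeroExt.inlAlgHom K _ _).toLinearMap ∘ₗ ι K M +
    (TrivSqZeroExt.inrHom (SymmetricAlgebra K M) (SymmetricAlgebra K M)).restrictScalars K ∘ₗ f)

theorem fst_derivAux (f : M →ₗ[K] SymmetricAlgebra K M) (a : SymmetricAlgebra K M) :
    (derivAux f a).fst = a := by
  induction a using SymmetricAlgebra.induction with
  | algebraMap r => rw [AlgHom.commutes]; rfl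
  | ι x => simp [derivAux]
  | mul a b ha hb => simp [ha, hb]
  | add a b ha hb => simp [ha, hb]

/-- The unique derivation of `S(M)` that extends the linear map `f : M → S(M)`. -/
def derivExt (f : M →ₗ[K] SymmetricAlgebra K M) :
    SymmetricAlgebra K M →ₗ[K] SymmetricAlgebra K M :=
  ((TrivSqZeroExt.sndHom (SymmetricAlgebra K M) (SymmetricAlgebra K M)).restrictScalars K) ∘ₗ
    (derivAux f).toLinearMap

theorem derivExt_ι (f : M →ₗ[K] SymmetricAlgebra K M) (x : M) :
    derivExt f (ι K M x) = f x := by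
  simp [derivExt, derivAux]

theorem derivExt_algebraMap (f : M →ₗ[K] SymmetricAlgebra K M) (r : K) :
    derivExt f (algebraMap K _ r) = 0 := by
  simp only [derivExt, LinearMap.comp_apply, AlgHom.toLinearMap_apply, AlgHom.commutes]
  rfl

theorem derivExt_mul (f : M →ₗ[K] SymmetricAlgebra K M) (a b : SymmetricAlgebra K M) :
    derivExt f (a * b) = a * derivExt f b + b * derivExt f a := by
  simp [derivExt, fst_derivAux, mul_comm]

/-- The extension of linear maps to derivations, as a linear map. -/
def derivExtHom : (M →ₗ[K] SymmetricAlgebra K M) →ₗ[K]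
    (SymmetricAlgebra K M →ₗ[K] SymmetricAlgebra K M) where
  toFun := derivExt
  map_add' f g := by
    ext a
    induction a using SymmetricAlgebra.induction with
    | algebraMap r => simp [derivExt_algebraMap]
    | ι x => simp [derivExt_ι]
    | mul a b ha hb =>
      simp only [derivExt_mul, LinearMap.add_apply] at ha hb ⊢
      rw [ha, hb]; ring
    | add a b ha hb => simp only [map_add, ha, hb]
  map_smul' c f := by
    ext a
    induction a using SymmetricAlgebra.induction with
    | algebraMap r => simp [derivExt_algebraMap]
    | ι x => simp [derivExt_ι]
    | mul a b ha hb =>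
      simp only [derivExt_mul, LinearMap.smul_apply, RingHom.id_apply] at ha hb ⊢
      rw [ha, hb]; simp only [mul_smul_comm, smul_add]
    | add a b ha hb => simp only [map_add, ha, hb]

end Derivation

section Poisson

variable {K L : Type*} [CommRing K] [LieRing L] [LieAlgebra K L]

/-- The map `L → S(L)`, `y ↦ [x, y]`. -/
def adι : L →ₗ[K] L →ₗ[K] SymmetricAlgebra K L :=
  LinearMap.mk₂ K (fun x y => ι K L ⁅x, y⁆)
    (by intros; simp) (by intros; simp) (by intros; simp) (by intros; simp)

theorem adι_apply (x y : L) : adι (K := K) x y = ι K L ⁅x, y⁆ := rfl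

/-- The Poisson bracket of `S(L)`: the biderivation with `{x, y} = [x, y]` for `x, y ∈ L`. For
`x ∈ L`, the map `{x, ·}` is the derivation that extends `y ↦ [x, y]`; for `b ∈ S(L)`, the map
`{·, b}` is the derivation that extends `x ↦ {x, b}`. -/
def poissonBracket :
    SymmetricAlgebra K L →ₗ[K] SymmetricAlgebra K L →ₗ[K] SymmetricAlgebra K L :=
  (derivExtHom ∘ₗ (derivExtHom ∘ₗ adι).flip).flip

theorem derivExtHom_apply {M : Type*} [AddCommGroup M] [Module K M]
    (f : M →ₗ[K] SymmetricAlgebra K M) : derivExtHom f = derivExt f := by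
  rw [derivExtHom, LinearMap.coe_mk, AddHom.coe_mk]

theorem poissonBracket_apply (a b : SymmetricAlgebra K L) :
    poissonBracket a b = derivExt ((derivExtHom ∘ₗ adι).flip b) a := by
  rw [poissonBracket, LinearMap.flip_apply, LinearMap.comp_apply, derivExtHom_apply]

theorem poissonBracket_ι_left (x : L) (b : SymmetricAlgebra K L) :
    poissonBracket (ι K L x) b = derivExt (adι x) b := by
  rw [poissonBracket_apply, derivExt_ι, LinearMap.flip_apply, LinearMap.comp_apply,
    derivExtHom_apply]

theorem poissonBracket_ι_ι (x y : L) :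
    poissonBracket (ι K L x) (ι K L y) = ι K L ⁅x, y⁆ := by
  rw [poissonBracket_ι_left, derivExt_ι, adι_apply]

theorem poissonBracket_mul_left (a b c : SymmetricAlgebra K L) :
    poissonBracket (a * b) c = a * poissonBracket b c + b * poissonBracket a c := by
  simp only [poissonBracket_apply, derivExt_mul]

theorem poissonBracket_algebraMap_left (r : K) (c : SymmetricAlgebra K L) :
    poissonBracket (algebraMap K _ r) c = 0 := by
  rw [poissonBracket_apply, derivExt_algebraMap]

theorem poissonBracket_algebraMap_right (r : K) (a : SymmetricAlgebra K L) :
    poissonBracket a (algebraMap K _ r) = 0 := by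
  induction a using SymmetricAlgebra.induction with
  | algebraMap r => rw [poissonBracket_algebraMap_left]
  | ι x => rw [poissonBracket_ι_left, derivExt_algebraMap]
  | mul a b ha hb => rw [poissonBracket_mul_left, ha, hb]; simp
  | add a b ha hb => rw [map_add, LinearMap.add_apply, ha, hb, add_zero]

theorem poissonBracket_mul_right (a b c : SymmetricAlgebra K L) :
    poissonBracket a (b * c) = b * poissonBracket a c + c * poissonBracket a b := by
  induction a using SymmetricAlgebra.induction with
  | algebraMap r => simp [poissonBracket_algebraMap_left]
  | ι x => simp only [poissonBracket_ι_left, derivExt_mul]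
  | mul a a' ha ha' => simp only [poissonBracket_mul_left, ha, ha']; ring
  | add a a' ha ha' => simp only [map_add, LinearMap.add_apply, ha, ha']; ring

theorem poissonBracket_skew (a b : SymmetricAlgebra K L) :
    poissonBracket a b = -poissonBracket b a := by
  induction a using SymmetricAlgebra.induction with
  | algebraMap r => simp [poissonBracket_algebraMap_left, poissonBracket_algebraMap_right]
  | ι x =>
    induction b using SymmetricAlgebra.induction with
    | algebraMap r => simp [poissonBracket_algebraMap_left, poissonBracket_algebraMap_right]
    | ι y => rw [poissonBracket_ι_ι, poissonBracket_ι_ι, ← map_neg, lie_skew]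
    | mul b b' hb hb' =>
      rw [poissonBracket_mul_left, poissonBracket_mul_right, hb, hb']; ring
    | add b b' hb hb' => simp only [map_add, LinearMap.add_apply, hb, hb']; ring
  | mul a a' ha ha' => rw [poissonBracket_mul_left, poissonBracket_mul_right, ha, ha']; ring
  | add a a' ha ha' => simp only [map_add, LinearMap.add_apply, ha, ha']; ring

theorem poissonBracket_self (a : SymmetricAlgebra K L) : poissonBracket a a = 0 := by
  induction a using SymmetricAlgebra.induction with
  | algebraMap r => rw [poissonBracket_algebraMap_left]
  | ι x => rw [poissonBracket_ι_ι, lie_self, map_zero]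
  | mul a b ha hb =>
    simp only [poissonBracket_mul_left, poissonBracket_mul_right, ha, hb]
    rw [poissonBracket_skew b a]; ring
  | add a b ha hb =>
    simp only [map_add, LinearMap.add_apply, ha, hb]
    rw [poissonBracket_skew b a]; ring

theorem poissonBracket_jacobi (a b c : SymmetricAlgebra K L) :
    poissonBracket (poissonBracket a b) c + poissonBracket (poissonBracket b c) a +
      poissonBracket (poissonBracket c a) b = 0 := by
  induction a using SymmetricAlgebra.induction with
  | algebraMap r => simp [poissonBracket_algebraMap_left, poissonBracket_algebraMap_right]
  | ι x =>
    induction b using SymmetricAlgebra.induction with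
    | algebraMap r => simp [poissonBracket_algebraMap_left, poissonBracket_algebraMap_right]
    | ι y =>
      induction c using SymmetricAlgebra.induction with
      | algebraMap r => simp [poissonBracket_algebraMap_left, poissonBracket_algebraMap_right]
      | ι z =>
        simp only [poissonBracket_ι_ι, ← map_add]
        rw [← lie_skew ⁅x, y⁆ z, ← lie_skew ⁅y, z⁆ x, ← lie_skew ⁅z, x⁆ y, ← neg_add, ← neg_add,
          add_assoc, add_comm, lie_jacobi, neg_zero, map_zero]
      | mul c c' hc hc' =>
        simp only [poissonBracket_mul_left, poissonBracket_mul_right, map_add,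
          LinearMap.add_apply]
        linear_combination c * hc' + c' * hc +
          poissonBracket c' (ι K L x) * poissonBracket_skew (ι K L y) c +
          poissonBracket c (ι K L x) * poissonBracket_skew (ι K L y) c'
      | add c c' hc hc' =>
        simp only [map_add, LinearMap.add_apply]
        linear_combination hc + hc'
    | mul b b' hb hb' =>
      simp only [poissonBracket_mul_left, poissonBracket_mul_right, map_add,
        LinearMap.add_apply]
      linear_combination b * hb' + b' * hb +
        poissonBracket b c * poissonBracket_skew (ι K L x) b' +
        poissonBracket b' c * poissonBracket_skew (ι K L x) b
    | add b b' hb hb' =>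
      simp only [map_add, LinearMap.add_apply]
      linear_combination hb + hb'
  | mul a a' ha ha' =>
    simp only [poissonBracket_mul_left, poissonBracket_mul_right, map_add,
      LinearMap.add_apply]
    linear_combination a * ha' + a' * ha +
      poissonBracket a' b * poissonBracket_skew a c + poissonBracket a b * poissonBracket_skew a' c
  | add a a' ha ha' =>
    simp only [map_add, LinearMap.add_apply]
    linear_combination ha + ha'

/-- The symmetric Poisson algebra `S(L)` of a Lie algebra `L`. -/
instance instPoissonAlgebra : PoissonAlgebra K (SymmetricAlgebra K L) where
  bracket := poissonBracket
  bracket_self := poissonBracket_self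
  jacobi := poissonBracket_jacobi
  leibniz := poissonBracket_mul_left

end Poisson

end SymmetricAlgebra

/-- The ideal of `S(L)` generated by all `v ^ p`, `v ∈ L`. -/
def truncIdeal (K L : Type*) [CommRing K] [AddCommGroup L] [Module K L] (p : ℕ) :
    Ideal (SymmetricAlgebra K L) :=
  Ideal.span {a | ∃ v : L, a = SymmetricAlgebra.ι K L v ^ p}

/-- The truncated symmetric algebra `s(L) = S(L) / (v ^ p | v ∈ L)`. -/
abbrev TruncatedSymmetricAlgebra (K L : Type*) [CommRing K] [AddCommGroup L] [Module K L]
    (p : ℕ) : Type _ :=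
  SymmetricAlgebra K L ⧸ truncIdeal K L p

namespace TruncatedSymmetricAlgebra

open SymmetricAlgebra

section Basic

variable (K L : Type*) [CommRing K] [AddCommGroup L] [Module K L] (p : ℕ)

/-- The canonical map `L → s(L)`. -/
def ι : L →ₗ[K] TruncatedSymmetricAlgebra K L p :=
  (Ideal.Quotient.mkₐ K (truncIdeal K L p)).toLinearMap ∘ₗ SymmetricAlgebra.ι K L

end Basic

variable {K L : Type*} [CommRing K] [LieRing L] [LieAlgebra K L] {p : ℕ}

theorem poissonBracket_pow_left (n : ℕ) (a b : SymmetricAlgebra K L) :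
    poissonBracket (a ^ n) b = (n : SymmetricAlgebra K L) * (a ^ (n - 1) * poissonBracket a b) := by
  induction n with
  | zero =>
    rw [pow_zero, ← map_one (algebraMap K (SymmetricAlgebra K L)),
      poissonBracket_algebraMap_left]
    simp
  | succ n ih =>
    rw [pow_succ, poissonBracket_mul_left, ih]
    rcases n with _ | n
    · simp
    · rw [show n + 1 + 1 - 1 = n + 1 from rfl, show n + 1 - 1 = n from rfl]
      push_cast
      ring

variable [CharP K p]

theorem poissonBracket_mem_left {a : SymmetricAlgebra K L} (ha : a ∈ truncIdeal K L p)
    (b : SymmetricAlgebra K L) : poissonBracket a b ∈ truncIdeal K L p := by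
  refine Submodule.span_induction ?_ ?_ ?_ ?_ ha
  · rintro _ ⟨v, rfl⟩
    have h : (p : SymmetricAlgebra K L) = 0 := by
      rw [← map_natCast (algebraMap K (SymmetricAlgebra K L)), CharP.cast_eq_zero, map_zero]
    rw [poissonBracket_pow_left, h, zero_mul]
    exact zero_mem _
  · simp
  · intro x y _ _ hx hy
    rw [map_add, LinearMap.add_apply]
    exact add_mem hx hy
  · intro c x hx' hx
    rw [smul_eq_mul, poissonBracket_mul_left]
    exact add_mem (Ideal.mul_mem_left _ _ hx) (Ideal.mul_mem_right _ _ hx')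

/-- The truncated symmetric Poisson algebra `s(L)` over a ring `K` of characteristic `p`, with the
bracket `{a + (v ^ p), b + (v ^ p)} = {a, b} + (v ^ p)`. -/
instance instPoissonAlgebra : PoissonAlgebra K (TruncatedSymmetricAlgebra K L p) :=
  PoissonAlgebra.quotient (truncIdeal K L p) (fun _ ha b => poissonBracket_mem_left ha b)

end TruncatedSymmetricAlgebra

section LieAlgebra

variable (K L : Type*) [CommRing K] [LieRing L] [LieAlgebra K L]

/-- The lower central series of the Lie algebra `L`, with shifted index: `lieGamma K L n` is
`γ_{n+1}(L)`. -/
def lieGamma (n : ℕ) : Submodule K L :=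
  (LieModule.lowerCentralSeries K L L n).toSubmodule

/-- The factor `γ_{n+1}(L) / γ_{n+2}(L)` of the lower central series of `L`. -/
abbrev LieGammaFactor (n : ℕ) : Type _ :=
  lieGamma K L n ⧸ (lieGamma K L (n + 1)).submoduleOf (lieGamma K L n)

/-- The Poisson dimension subalgebra `L ∩ S(L)^{(n)}`. -/
def poissonDimension (n : ℕ) : Submodule K L :=
  ((PoissonAlgebra.upperPower K (SymmetricAlgebra K L) n).restrictScalars K).comap
    (SymmetricAlgebra.ι K L)

/-- The truncated Poisson dimension subalgebra `L ∩ s(L)^{(n)}`. -/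
def truncatedPoissonDimension (p : ℕ) [CharP K p] (n : ℕ) : Submodule K L :=
  ((PoissonAlgebra.upperPower K (TruncatedSymmetricAlgebra K L p) n).restrictScalars K).comap
    (TruncatedSymmetricAlgebra.ι K L p)

end LieAlgebra

end

/-! Part (a) is the chain `lieGamma` ≤ `poissonDimension` ≤ `truncatedPoissonDimension` ≤
`lieGamma`, whose last link carries the content. Since p ≥ 2, s(L) projects onto K ⊕ L with L² = 0,
and a bracket goes to the Lie bracket of the linear parts (`toTrivSqZeroExt_bracket`); hence linear
parts of s(L)^{(n)} lie in γ_{n+1}(L).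

For (b), an infinite-dimensional factor would put elements congruent to nonzero products of
commutators, modulo a Poisson ideal, into every γ_k(s(L)) (`finiteDimensional_of_gamma_eq_bot`). As
L embeds in s(L), it is nilpotent, so [L, L] has a finite basis of commutators e_s, adapted to the
lower central series, with e_s ∈ γ_{w_s+1}(L) and N = 1 + (p-1) ∑ w_s. Each bracket raises by one
the weight of the ideals generated by monomials in the e_s, and weight above (p-1) ∑ w_s forces an
exponent p; so s(L)^{(N)} = 0. Conversely, upper powers multiply (`mul_mem_upperPower`), so the
nonzero monomial ∏ e_s^{p-1} lies in s(L)^{(N-1)}.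

For p > 3 the same monomial is shown to lie in the ideal generated by γ_N(s(L)). When 6 is
invertible, the ideal generated by an odd term γ_{m+1} still brackets s(L) into γ_{m+2}
(`bracket_mem_gamma_of_mem_gammaIdeal`); the induction rests on the symmetries of a five-letter
expression. Therefore such ideals multiply well when one index is odd, and squares {x, y}² reach the
expected depth (`bracket_sq_mem_gammaIdeal`). Since p-1 is even and each e_s is a single commutator,
this suffices. -/

/-! ### Lower central series of a Poisson algebra when 6 is invertible -/

/-- A function of five letters that is alternating in the first two and in the last three, and
satisfies a Jacobi identity, vanishes on distinct letters where `6` is invertible. -/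
theorem eq_zero_of_skew_of_jacobi {M : Type*} [AddCommGroup M]
    (T : Fin 5 → Fin 5 → Fin 5 → Fin 5 → Fin 5 → M)
    (h₁ : ∀ a b x y e, [a, b, x, y, e].Nodup → T a b x y e + T b a x y e = 0)
    (h₂ : ∀ a b x y e, [a, b, x, y, e].Nodup → T a b x y e + T a b y x e = 0)
    (h₃ : ∀ a b x y e, [a, b, x, y, e].Nodup → T a b x y e + T a b e y x = 0)
    (hJ : ∀ a b x y e, [a, b, x, y, e].Nodup → T a b x y e + T b y x a e + T y a x b e = 0)
    (hM : ∀ m : M, (6 : ℤ) • m = 0 → m = 0) : T 0 1 2 3 4 = 0 := by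
  have hM2 : ∀ m : M, (2 : ℤ) • m = 0 → m = 0 := fun m hm => hM m (by
    rw [show (6 : ℤ) = 3 * 2 by norm_num, mul_smul, hm, smul_zero])
  have hM3 : ∀ m : M, (3 : ℤ) • m = 0 → m = 0 := fun m hm => hM m (by
    rw [show (6 : ℤ) = 2 * 3 by norm_num, mul_smul, hm, smul_zero])
  -- With `e` fixed, `T` has the symmetries of a curvature tensor: skew in each pair, with a Bianchi
  -- identity. Four instances of the latter give the pair symmetry, up to a factor 2.
  have key : ∀ a b x y e, [a, b, x, y, e].Nodup → T a b x y e = T x y a b e := by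
    intro a b c d e h
    rw [← sub_eq_zero]
    refine hM2 _ ?_
    linear_combination (norm := module)
      -hJ a b d c e (by grind) + hJ a b c d e (by grind) + hJ c d b a e (by grind)
        - hJ c d a b e (by grind) + h₂ a b d c e (by grind) + h₂ b c d a e (by grind)
        + h₂ c a d b e (by grind) - h₁ c a b d e (by grind) - h₂ b d c a e (by grind)
        - h₂ d a c b e (by grind) - h₂ c d b a e (by grind) + h₁ d b a c e (by grind)
  have cyc : ∀ a b x y e, [a, b, x, y, e].Nodup → T a b x y e = T a b y e x := by
    intro a b x y e h
    linear_combination (norm := module) h₃ a b x y e h - h₂ a b e y x (by clear * - h; grind)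
  -- Pair symmetry followed by cycling the last three letters rotates all five letters. These
  -- equalities identify the three terms of one Jacobi identity up to a common sign, so that 3T = 0.
  have e₁ : T 0 1 2 3 4 = T 2 3 4 0 1 :=
    (key 0 1 2 3 4 (by decide)).trans ((cyc 2 3 0 1 4 (by decide)).trans
      (cyc 2 3 1 4 0 (by decide)))
  have e₂ : T 2 3 4 0 1 = T 4 0 1 2 3 :=
    (key 2 3 4 0 1 (by decide)).trans ((cyc 4 0 2 3 1 (by decide)).trans
      (cyc 4 0 3 1 2 (by decide)))
  have e₃ : T 4 0 1 2 3 = T 1 2 3 4 0 :=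
    (key 4 0 1 2 3 (by decide)).trans ((cyc 1 2 4 0 3 (by decide)).trans
      (cyc 1 2 0 3 4 (by decide)))
  have e₄ : T 1 2 3 4 0 = T 3 4 0 1 2 :=
    (key 1 2 3 4 0 (by decide)).trans ((cyc 3 4 1 2 0 (by decide)).trans
      (cyc 3 4 2 0 1 (by decide)))
  have e₅ : T 3 4 0 1 2 = T 2 0 3 4 1 := by
    rw [cyc 3 4 0 1 2 (by decide), cyc 3 4 1 2 0 (by decide), key 3 4 2 0 1 (by decide)]
  have e₆ := hJ 0 1 3 2 4 (by decide)
  refine hM3 _ ?_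
  have e₇ : T 0 1 3 2 4 = -T 0 1 2 3 4 := eq_neg_of_add_eq_zero_left (h₂ 0 1 3 2 4 (by decide))
  have e₈ : T 1 2 3 0 4 = -T 1 2 3 4 0 :=
    eq_neg_of_add_eq_zero_left (by
      linear_combination (norm := module) h₂ 1 2 3 0 4 (by decide) - cyc 1 2 0 3 4 (by decide))
  have e₉ : T 2 0 3 1 4 = -T 2 0 3 4 1 :=
    eq_neg_of_add_eq_zero_left (by
      linear_combination (norm := module) h₂ 2 0 3 1 4 (by decide) - cyc 2 0 1 3 4 (by decide))
  rw [e₇, e₈, e₉, ← e₅, ← e₄, ← e₃, ← e₂, ← e₁] at e₆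
  linear_combination (norm := module) -e₆

namespace PoissonAlgebra

section Series

variable {K A : Type*} [CommRing K] [CommRing A] [Algebra K A] [PoissonAlgebra K A]

theorem leibniz_right (a b c : A) :
    bracket (K := K) a (b * c) = b * bracket (K := K) a c + c * bracket (K := K) a b := by
  rw [bracket_skew, leibniz, bracket_skew b a, bracket_skew c a]
  ring

theorem jacobi_left (a b c : A) :
    bracket (K := K) (bracket (K := K) a b) c =
      bracket (K := K) (bracket (K := K) a c) b + bracket (K := K) a (bracket (K := K) b c) := by
  have h := jacobi (K := K) a b c
  rw [bracket_skew (bracket (K := K) b c) a, bracket_skew c a, map_neg, LinearMap.neg_apply] at h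
  linear_combination h

theorem bracket_mem_gamma_succ {n : ℕ} {a : A} (ha : a ∈ gamma K A n) (b : A) :
    bracket (K := K) a b ∈ gamma K A (n + 1) :=
  Submodule.subset_span ⟨a, ha, b, rfl⟩

/-- If `t` brackets `A` into `γ`-degree `m + 1`, it brackets `γ`-degree `k` into
`γ`-degree `m + k + 1`. -/
theorem bracket_mem_gamma_add_of_forall {m : ℕ} {I : Set A}
    (hI : ∀ t ∈ I, ∀ r : A, bracket (K := K) t r ∈ gamma K A (m + 1)) {t : A} (ht : t ∈ I) {k : ℕ}
    {u : A} (hu : u ∈ gamma K A k) : bracket (K := K) t u ∈ gamma K A (m + k + 1) := by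
  -- The induction replaces `t` by `{t, b}`, which may leave `I`; the hypothesis is therefore kept
  -- for a single element and an arbitrary depth.
  suffices H : ∀ k n, ∀ t : A, (∀ r : A, bracket (K := K) t r ∈ gamma K A (n + 1)) →
      ∀ u ∈ gamma K A k, bracket (K := K) t u ∈ gamma K A (n + k + 1) from
    H k m t (hI t ht) u hu
  intro k
  induction k with
  | zero => intro n t ht u _; exact ht u
  | succ k ih =>
    intro n t ht u hu
    induction hu using Submodule.span_induction with
    | mem x hx =>
      obtain ⟨a, ha, b, rfl⟩ := hx
      have h := jacobi_left (K := K) t a b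
      rw [← sub_eq_iff_eq_add'] at h
      rw [← h]
      refine sub_mem (bracket_mem_gamma_succ (ih n t ht a ha) b) ?_
      have := ih (n + 1) (bracket (K := K) t b)
        (fun r => bracket_mem_gamma_succ (ht b) r) a ha
      rwa [show n + 1 + k + 1 = n + (k + 1) + 1 by ring] at this
    | zero => rw [map_zero]; exact zero_mem _
    | add x y _ _ hx hy => rw [map_add]; exact add_mem hx hy
    | smul c x _ hx => rw [map_smul]; exact Submodule.smul_mem _ _ hx

theorem bracket_mem_gamma_add {m k : ℕ} {t u : A} (ht : t ∈ gamma K A m) (hu : u ∈ gamma K A k) :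
    bracket (K := K) t u ∈ gamma K A (m + k + 1) :=
  bracket_mem_gamma_add_of_forall (I := gamma K A m) (fun _ ht r => bracket_mem_gamma_succ ht r)
    ht hu

variable (K A) in
/-- The ideal generated by a term of the lower central series. -/
def gammaIdeal (n : ℕ) : Ideal A := Ideal.span (gamma K A n : Set A)

theorem gammaIdeal_zero : gammaIdeal K A 0 = ⊤ :=
  Ideal.eq_top_of_isUnit_mem _ (Ideal.subset_span (Submodule.mem_top (x := (1 : A)))) isUnit_one

theorem gamma_le_gammaIdeal {n : ℕ} {a : A} (ha : a ∈ gamma K A n) : a ∈ gammaIdeal K A n :=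
  Ideal.subset_span ha

theorem gammaIdeal_ne_bot {n : ℕ} (h : gammaIdeal K A n ≠ ⊥) : gamma K A n ≠ ⊥ := by
  intro h'
  apply h
  rw [gammaIdeal, h', Submodule.bot_coe, Ideal.span_singleton_zero]

/-- The property `P` need not be stable under multiplication: in the applications it may be
membership in a term of the lower central series, which is only a linear subspace. -/
theorem gammaIdeal_induction {n : ℕ} {P : A → Prop} (h0 : P 0) (hadd : ∀ a b, P a → P b → P (a + b))
    (h : ∀ r, ∀ u ∈ gamma K A n, P (r * u)) {t : A} (ht : t ∈ gammaIdeal K A n) : P t := by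
  suffices H : ∀ r, P (r * t) by simpa using H 1
  induction ht using Submodule.span_induction with
  | mem x hx => exact fun r => h r x hx
  | zero => intro r; rwa [mul_zero]
  | add x y _ _ hx hy => intro r; rw [mul_add]; exact hadd _ _ (hx r) (hy r)
  | smul c x _ hx => intro r; rw [smul_eq_mul, ← mul_assoc]; exact hx _

/-- The key computation for the step from `m` to `m + 2` below. -/
theorem bracket_mul_bracket_bracket_mem {m : ℕ} (h6 : IsUnit (6 : K))
    (hm : ∀ t ∈ gammaIdeal K A m, ∀ r : A, bracket (K := K) t r ∈ gamma K A (m + 1))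
    {w : A} (hw : w ∈ gamma K A m) (r a b e : A) :
    bracket (K := K) (r * bracket (K := K) (bracket (K := K) w a) b) e ∈ gamma K A (m + 3) := by
  set v : Fin 5 → A := ![w, a, r, b, e] with hv
  let T : Fin 5 → Fin 5 → Fin 5 → Fin 5 → Fin 5 → A ⧸ gamma K A (m + 3) := fun a b x y e =>
    (gamma K A (m + 3)).mkQ
      (bracket (K := K) (v x * bracket (K := K) (bracket (K := K) (v a) (v b)) (v y)) (v e))
  have h0 : v 0 ∈ gamma K A m := hw
  -- Five distinct letters use up `Fin 5`, so the deep letter `w = v 0` occurs in some position; the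
  -- relations below must hold wherever it stands.
  have hex : ∀ a b x y e : Fin 5, [a, b, x, y, e].Nodup →
      a = 0 ∨ b = 0 ∨ x = 0 ∨ y = 0 ∨ e = 0 := by decide +kernel
  have P0 : ∀ a : A, a ∈ gamma K A 0 := fun a => Submodule.mem_top
  have hl : ∀ r, v 0 * r ∈ gammaIdeal K A m := fun r =>
    Ideal.mul_mem_right _ _ (gamma_le_gammaIdeal h0)
  have hr : ∀ r, r * v 0 ∈ gammaIdeal K A m := fun r =>
    Ideal.mul_mem_left _ _ (gamma_le_gammaIdeal h0)
  have B : ∀ {t : A}, t ∈ gammaIdeal K A m → ∀ {k : ℕ} {u : A}, u ∈ gamma K A k →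
      bracket (K := K) u t ∈ gamma K A (m + k + 1) := fun ht k u hu => by
    rw [bracket_skew]
    exact neg_mem (bracket_mem_gamma_add_of_forall (I := gammaIdeal K A m) hm ht hu)
  have br : ∀ (i j : Fin 5), bracket (K := K) (v i) (v j) ∈ gamma K A 1 := fun i j =>
    bracket_mem_gamma_succ (P0 _) _
  have bl : ∀ j : Fin 5, bracket (K := K) (v 0) (v j) ∈ gamma K A (m + 1) := fun j =>
    bracket_mem_gamma_succ h0 _
  have bl' : ∀ j : Fin 5, bracket (K := K) (v j) (v 0) ∈ gamma K A (m + 1) := fun j => by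
    rw [bracket_skew]; exact neg_mem (bl j)
  -- Expanding {{a, b}, xy} by Leibniz turns this into skewness of `T` in `x, y`. If `w` is a factor
  -- of the product, the hypothesis on the ideal at depth `m` is needed.
  have H1 : ∀ a b x y e, [a, b, x, y, e].Nodup → bracket (K := K) (bracket (K := K)
      (bracket (K := K) (v a) (v b)) (v x * v y)) (v e) ∈ gamma K A (m + 3) := by
    intro a b x y e h
    rcases hex a b x y e h with rfl | rfl | rfl | rfl | rfl
    · exact bracket_mem_gamma_succ (bracket_mem_gamma_succ (bl _) _) _
    · exact bracket_mem_gamma_succ (bracket_mem_gamma_succ (bl' _) _) _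
    · exact bracket_mem_gamma_succ (B (hl _) (br _ _)) _
    · exact bracket_mem_gamma_succ (B (hr _) (br _ _)) _
    · exact B (gamma_le_gammaIdeal h0) (bracket_mem_gamma_succ (br _ _) _)
  -- Likewise, expanding the bracket with xe gives skewness of `T` in `x, e`.
  have H2 : ∀ a b x y e, [a, b, x, y, e].Nodup → bracket (K := K) (bracket (K := K)
      (bracket (K := K) (v a) (v b)) (v y)) (v x * v e) ∈ gamma K A (m + 3) := by
    intro a b x y e h
    rcases hex a b x y e h with rfl | rfl | rfl | rfl | rfl
    · exact bracket_mem_gamma_succ (bracket_mem_gamma_succ (bl _) _) _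
    · exact bracket_mem_gamma_succ (bracket_mem_gamma_succ (bl' _) _) _
    · exact B (hl _) (bracket_mem_gamma_succ (br _ _) _)
    · exact bracket_mem_gamma_succ (B (gamma_le_gammaIdeal h0) (br _ _)) _
    · exact B (hr _) (bracket_mem_gamma_succ (br _ _) _)
  have key : T 0 1 2 3 4 = 0 := by
    apply eq_zero_of_skew_of_jacobi T
    · intro a b x y e _
      simp only [T, ← map_add]
      rw [bracket_skew (v b) (v a)]
      simp
    · intro a b x y e h
      simp only [T, ← map_add]
      rw [Submodule.mkQ_apply, Submodule.Quotient.mk_eq_zero]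
      convert H1 a b x y e h using 1
      rw [leibniz_right, map_add, LinearMap.add_apply]
    · intro a b x y e h
      simp only [T, ← map_add]
      rw [Submodule.mkQ_apply, Submodule.Quotient.mk_eq_zero]
      convert H2 a b x y e h using 1
      simp only [leibniz, leibniz_right]
      rw [bracket_skew (v e) (v x)]
      ring
    · intro a b x y e _
      simp only [T, ← map_add, ← LinearMap.add_apply, ← mul_add]
      rw [jacobi]
      simp
    · obtain ⟨u, hu⟩ := h6
      intro q hq
      have h : (6 : K) • q = 0 := by
        rw [← hq, ← Int.cast_smul_eq_zsmul K]; norm_num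
      rw [← hu] at h
      rwa [← u.smul_def, smul_eq_zero_iff_eq] at h
  simpa [T, hv] using key

/-- If `6` is invertible, the ideal generated by an odd term `γ_{m+1}(A)` (so `m` is even) brackets
`A` into `γ_{m+2}(A)`. -/
theorem bracket_mem_gamma_of_mem_gammaIdeal (h6 : IsUnit (6 : K)) {m : ℕ} (hm : Even m) :
    ∀ t ∈ gammaIdeal K A m, ∀ r : A, bracket (K := K) t r ∈ gamma K A (m + 1) := by
  obtain ⟨k, rfl⟩ := hm
  induction k with
  | zero => exact fun t _ r => bracket_mem_gamma_succ Submodule.mem_top r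
  | succ k ih =>
    intro t ht e
    rw [show k + 1 + (k + 1) + 1 = k + k + 3 by ring]
    refine gammaIdeal_induction (K := K)
      (P := fun t => bracket (K := K) t e ∈ gamma K A (k + k + 3)) ?_ ?_ ?_ ht
    · rw [map_zero, LinearMap.zero_apply]; exact zero_mem _
    · intro a b ha hb; rw [map_add, LinearMap.add_apply]; exact add_mem ha hb
    · intro r u hu
      -- Two brackets are peeled off `u`, which leaves the inner element at the even depth covered
      -- by the induction hypothesis.
      rw [show k + 1 + (k + 1) = k + k + 1 + 1 by ring] at hu
      induction hu using Submodule.span_induction with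
      | mem x hx =>
        obtain ⟨u', hu', b, rfl⟩ := hx
        induction hu' using Submodule.span_induction with
        | mem x hx =>
          obtain ⟨w, hw, a, rfl⟩ := hx
          exact bracket_mul_bracket_bracket_mem h6 ih hw r a b e
        | zero => simp
        | add x y _ _ hx hy =>
          simp only [map_add, LinearMap.add_apply, mul_add]; exact add_mem hx hy
        | smul c x _ hx =>
          simp only [map_smul, LinearMap.smul_apply, mul_smul_comm]
          exact Submodule.smul_mem _ _ hx
      | zero => simp
      | add x y _ _ hx hy => simp only [map_add, LinearMap.add_apply, mul_add]; exact add_mem hx hy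
      | smul c x _ hx =>
        simp only [map_smul, LinearMap.smul_apply, mul_smul_comm]
        exact Submodule.smul_mem _ _ hx

/-- By Leibniz, w{v, b} = {v, wb} - b{v, w}. The first bracket is deep because `wb` lies in an ideal
with even shifted index; the second is an ordinary bracket of two terms of the series. -/
theorem mul_mem_gammaIdeal_of_even (h6 : IsUnit (6 : K)) {m n : ℕ} (hm : Even m) {s t : A}
    (hs : s ∈ gammaIdeal K A m) (ht : t ∈ gammaIdeal K A n) : s * t ∈ gammaIdeal K A (m + n) := by
  rcases n with _ | n
  · exact Ideal.mul_mem_right _ _ hs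
  refine gammaIdeal_induction (K := K)
    (P := fun t => s * t ∈ gammaIdeal K A (m + (n + 1))) ?_ ?_ ?_ ht
  · rw [mul_zero]; exact zero_mem _
  · intro a b ha hb; rw [mul_add]; exact add_mem ha hb
  intro r u hu
  rw [mul_left_comm]
  refine Ideal.mul_mem_left _ _ ?_
  refine gammaIdeal_induction (K := K)
    (P := fun s => s * u ∈ gammaIdeal K A (m + (n + 1))) ?_ ?_ ?_ hs
  · rw [zero_mul]; exact zero_mem _
  · intro a b ha hb; rw [add_mul]; exact add_mem ha hb
  intro r w hw
  rw [mul_assoc]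
  refine Ideal.mul_mem_left _ _ ?_
  induction hu using Submodule.span_induction with
  | mem x hx =>
    obtain ⟨v, hv, b, rfl⟩ := hx
    have h1 : bracket (K := K) v (w * b) ∈ gamma K A (m + (n + 1)) := by
      rw [bracket_skew]
      exact neg_mem (bracket_mem_gamma_add_of_forall (I := gammaIdeal K A m)
        (bracket_mem_gamma_of_mem_gammaIdeal h6 hm)
        (Ideal.mul_mem_right _ _ (gamma_le_gammaIdeal hw)) hv)
    have h2 : bracket (K := K) v w ∈ gamma K A (m + (n + 1)) := by
      rw [bracket_skew]
      exact neg_mem (bracket_mem_gamma_add hw hv)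
    have h3 : w * bracket (K := K) v b = bracket (K := K) v (w * b) - b * bracket (K := K) v w := by
      rw [leibniz_right]; ring
    rw [h3]
    exact sub_mem (gamma_le_gammaIdeal h1) (Ideal.mul_mem_left _ _ (gamma_le_gammaIdeal h2))
  | zero => simp
  | add x y _ _ hx hy => rw [mul_add]; exact add_mem hx hy
  | smul c x _ hx => rw [mul_smul_comm]; exact Submodule.smul_of_tower_mem _ _ hx

/-- The identity {x, y}² = {{x, xy}, y} - x{{x, y}, y} holds. In the first term `xy` lies in the
ideal at even depth `m`, so {x, xy} has depth 2m + 1; the second is a product with an even factor.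
-/
theorem bracket_sq_mem_gammaIdeal (h6 : IsUnit (6 : K)) {m : ℕ} (hm : Even m) {x : A}
    (hx : x ∈ gamma K A m) (y : A) :
    bracket (K := K) x y ^ 2 ∈ gammaIdeal K A (2 * (m + 1)) := by
  have h1 : bracket (K := K) (bracket (K := K) x (x * y)) y ∈ gamma K A (2 * (m + 1)) := by
    rw [show 2 * (m + 1) = m + m + 1 + 1 by ring]
    refine bracket_mem_gamma_succ ?_ y
    rw [bracket_skew]
    exact neg_mem (bracket_mem_gamma_add_of_forall (I := gammaIdeal K A m)
      (bracket_mem_gamma_of_mem_gammaIdeal h6 hm)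
      (Ideal.mul_mem_right _ _ (gamma_le_gammaIdeal hx)) hx)
  have h2 : x * bracket (K := K) (bracket (K := K) x y) y ∈ gammaIdeal K A (m + (m + 2)) :=
    mul_mem_gammaIdeal_of_even h6 hm (gamma_le_gammaIdeal hx)
      (gamma_le_gammaIdeal (bracket_mem_gamma_succ (bracket_mem_gamma_succ hx y) y))
  rw [show m + (m + 2) = 2 * (m + 1) by ring] at h2
  have h3 : bracket (K := K) x y ^ 2 = bracket (K := K) (bracket (K := K) x (x * y)) y -
      x * bracket (K := K) (bracket (K := K) x y) y := by
    rw [leibniz_right, bracket_self, mul_zero, add_zero, leibniz]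
    ring
  rw [h3]
  exact sub_mem (gamma_le_gammaIdeal h1) h2

theorem pow_mem_gammaIdeal (h6 : IsUnit (6 : K)) {m : ℕ} (hm : Even m) {s : A}
    (hs : s ∈ gammaIdeal K A m) (k : ℕ) : s ^ k ∈ gammaIdeal K A (k * m) := by
  induction k with
  | zero => rw [zero_mul, gammaIdeal_zero]; exact Submodule.mem_top
  | succ k ih =>
    rw [pow_succ', show (k + 1) * m = m + k * m by ring]
    exact mul_mem_gammaIdeal_of_even h6 hm hs ih

/-- An even power of a bracket `{x, y}` with `x ∈ γ_{m+1}(A)`. -/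
theorem bracket_pow_mem_gammaIdeal (h6 : IsUnit (6 : K)) {m k : ℕ} (hk : Even k) {x : A}
    (hx : x ∈ gamma K A m) (y : A) :
    bracket (K := K) x y ^ k ∈ gammaIdeal K A (k * (m + 1)) := by
  -- If `m` is even, pairing the factors gives squares at even depth. If `m` is odd, {x, y} itself
  -- already has even depth.
  rcases Nat.even_or_odd m with hm | hm
  · obtain ⟨k, rfl⟩ := hk.two_dvd
    rw [pow_mul, show 2 * k * (m + 1) = k * (2 * (m + 1)) by ring]
    exact pow_mem_gammaIdeal h6 (even_two_mul _) (bracket_sq_mem_gammaIdeal h6 hm hx y) k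
  · exact pow_mem_gammaIdeal h6 hm.add_one
      (gamma_le_gammaIdeal (bracket_mem_gamma_succ hx y)) k

theorem prod_mem_gammaIdeal (h6 : IsUnit (6 : K)) {ι : Type*} (s : Finset ι) (a : ι → A)
    (m : ι → ℕ) (hm : ∀ i ∈ s, Even (m i)) (ha : ∀ i ∈ s, a i ∈ gammaIdeal K A (m i)) :
    ∏ i ∈ s, a i ∈ gammaIdeal K A (∑ i ∈ s, m i) := by
  classical
  induction s using Finset.induction_on with
  | empty => rw [Finset.sum_empty, gammaIdeal_zero]; exact Submodule.mem_top
  | insert i s hi ih =>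
    rw [Finset.prod_insert hi, Finset.sum_insert hi]
    exact mul_mem_gammaIdeal_of_even h6 (hm i (Finset.mem_insert_self i s))
      (ha i (Finset.mem_insert_self i s))
      (ih (fun j hj => hm j (Finset.mem_insert_of_mem hj))
        fun j hj => ha j (Finset.mem_insert_of_mem hj))

end Series

end PoissonAlgebra

/-! ### Multiplicativity of the upper Lie powers -/

namespace PoissonAlgebra

section UpperPower

variable {K A : Type*} [CommRing K] [CommRing A] [Algebra K A] [PoissonAlgebra K A]

theorem bracket_mem_upperPower_succ {n : ℕ} {a : A} (ha : a ∈ upperPower K A n) (b : A) :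
    bracket (K := K) a b ∈ upperPower K A (n + 1) :=
  Ideal.subset_span ⟨a, ha, b, rfl⟩

theorem gamma_le_upperPower (n : ℕ) {a : A} (ha : a ∈ gamma K A n) : a ∈ upperPower K A n := by
  induction n generalizing a with
  | zero => exact Submodule.mem_top
  | succ n ih =>
    induction ha using Submodule.span_induction with
    | mem x hx =>
      obtain ⟨a, ha, b, rfl⟩ := hx
      exact bracket_mem_upperPower_succ (ih ha) b
    | zero => exact zero_mem _
    | add x y _ _ hx hy => exact add_mem hx hy
    | smul c x _ hx => exact Submodule.smul_of_tower_mem _ _ hx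

/-- The identity a{c, d} = {ac, d} - c{a, d} shifts depth from one factor to the other. No parity
condition arises, because each upper power is itself an ideal. -/
theorem mul_mem_upperPower {m n : ℕ} {a b : A} (ha : a ∈ upperPower K A m)
    (hb : b ∈ upperPower K A n) : a * b ∈ upperPower K A (m + n) := by
  induction n generalizing m a b with
  | zero => exact Ideal.mul_mem_right _ _ ha
  | succ n ih =>
    induction hb using Submodule.span_induction with
    | mem x hx =>
      obtain ⟨c, hc, d, rfl⟩ := hx
      have h1 := bracket_mem_upperPower_succ (ih ha hc) d
      have h2 := ih (bracket_mem_upperPower_succ ha d) hc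
      rw [leibniz] at h1
      rw [show m + 1 + n = m + n + 1 by ring, mul_comm] at h2
      exact (add_mem_cancel_right h2).1 h1
    | zero => rw [mul_zero]; exact zero_mem _
    | add x y _ _ hx hy => rw [mul_add]; exact add_mem hx hy
    | smul c x _ hx => rw [smul_eq_mul, mul_left_comm]; exact Ideal.mul_mem_left _ _ hx

theorem pow_mem_upperPower {m : ℕ} {a : A} (ha : a ∈ upperPower K A m) (k : ℕ) :
    a ^ k ∈ upperPower K A (k * m) := by
  induction k with
  | zero => rw [zero_mul]; exact Submodule.mem_top
  | succ k ih =>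
    rw [pow_succ, add_mul, one_mul]
    exact mul_mem_upperPower ih ha

theorem prod_mem_upperPower {ι : Type*} (s : Finset ι) (a : ι → A) (m : ι → ℕ)
    (ha : ∀ i ∈ s, a i ∈ upperPower K A (m i)) :
    ∏ i ∈ s, a i ∈ upperPower K A (∑ i ∈ s, m i) := by
  classical
  induction s using Finset.induction_on with
  | empty => rw [Finset.sum_empty]; exact Submodule.mem_top
  | insert i s hi ih =>
    rw [Finset.prod_insert hi, Finset.sum_insert hi]
    exact mul_mem_upperPower (ha i (Finset.mem_insert_self i s))
      (ih fun j hj => ha j (Finset.mem_insert_of_mem hj))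

theorem bracket_algebraMap_left (r : K) (a : A) : bracket (K := K) (algebraMap K A r) a = 0 := by
  have h := leibniz (K := K) (1 : A) 1 a
  rw [Algebra.algebraMap_eq_smul_one, map_smul, LinearMap.smul_apply]
  rw [mul_one, one_mul] at h
  rw [left_eq_add.1 h, smul_zero]

theorem bracket_algebraMap_right (r : K) (a : A) : bracket (K := K) a (algebraMap K A r) = 0 := by
  rw [bracket_skew, bracket_algebraMap_left, neg_zero]

/-- A homomorphism of Poisson algebras maps upper Lie powers to upper Lie powers. -/
theorem map_mem_upperPower {B : Type*} [CommRing B] [Algebra K B] [PoissonAlgebra K B]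
    (f : A →ₐ[K] B)
    (hf : ∀ a b, f (bracket (K := K) a b) = bracket (K := K) (f a) (f b)) (n : ℕ) {a : A}
    (ha : a ∈ upperPower K A n) : f a ∈ upperPower K B n := by
  induction n generalizing a with
  | zero => exact Submodule.mem_top
  | succ n ih =>
    induction ha using Submodule.span_induction with
    | mem x hx =>
      obtain ⟨c, hc, d, rfl⟩ := hx
      rw [hf]
      exact bracket_mem_upperPower_succ (ih hc) _
    | zero => rw [map_zero]; exact zero_mem _
    | add x y _ _ hx hy => rw [map_add]; exact add_mem hx hy
    | smul c x _ hx => rw [smul_eq_mul, map_mul]; exact Ideal.mul_mem_left _ _ hx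

end UpperPower

end PoissonAlgebra

/-! ### Linear parts and the dimension subalgebras -/

section LieGamma

variable {K L : Type*} [CommRing K] [LieRing L] [LieAlgebra K L]

theorem lieGamma_succ (n : ℕ) :
    lieGamma K L (n + 1) = Submodule.span K {z | ∃ a ∈ lieGamma K L n, ∃ y : L, z = ⁅a, y⁆} := by
  rw [lieGamma, LieModule.lowerCentralSeries_succ, LieSubmodule.lieIdeal_oper_eq_linear_span']
  apply le_antisymm <;> rw [Submodule.span_le]
  · rintro _ ⟨x, -, n, hn, rfl⟩
    rw [← lie_skew, SetLike.mem_coe, neg_mem_iff]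
    exact Submodule.subset_span ⟨n, hn, x, rfl⟩
  · rintro _ ⟨a, ha, y, rfl⟩
    rw [← lie_skew, SetLike.mem_coe, neg_mem_iff]
    exact Submodule.subset_span ⟨y, trivial, a, ha, rfl⟩

theorem lie_mem_lieGamma_succ {n : ℕ} {a : L} (ha : a ∈ lieGamma K L n) (y : L) :
    ⁅a, y⁆ ∈ lieGamma K L (n + 1) := by
  rw [lieGamma_succ]
  exact Submodule.subset_span ⟨a, ha, y, rfl⟩

theorem lieGamma_antitone : Antitone (lieGamma K L) := fun _ _ h =>
  LieModule.antitone_lowerCentralSeries K L L h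

end LieGamma

namespace SymmetricAlgebra

variable {K L : Type*} [CommRing K] [LieRing L] [LieAlgebra K L]

theorem bracket_ι_ι (x y : L) : PoissonAlgebra.bracket (K := K) (ι K L x) (ι K L y) = ι K L ⁅x, y⁆ :=
  poissonBracket_ι_ι x y

theorem ι_mem_upperPower (n : ℕ) {x : L} (hx : x ∈ lieGamma K L n) :
    ι K L x ∈ PoissonAlgebra.upperPower K (SymmetricAlgebra K L) n := by
  induction n generalizing x with
  | zero => exact Submodule.mem_top
  | succ n ih =>
    rw [lieGamma_succ] at hx
    induction hx using Submodule.span_induction with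
    | mem x hx =>
      obtain ⟨a, ha, y, rfl⟩ := hx
      rw [← bracket_ι_ι]
      exact PoissonAlgebra.bracket_mem_upperPower_succ (ih ha) _
    | zero => rw [map_zero]; exact zero_mem _
    | add x y _ _ hx hy => rw [map_add]; exact add_mem hx hy
    | smul c x _ hx => rw [map_smul]; exact Submodule.smul_of_tower_mem _ _ hx

end SymmetricAlgebra

namespace TruncatedSymmetricAlgebra

section Lift

variable {K L : Type*} [CommRing K] [AddCommGroup L] [Module K L] {p : ℕ}

theorem ι_apply (x : L) :
    ι K L p x = Ideal.Quotient.mkₐ K (truncIdeal K L p) (SymmetricAlgebra.ι K L x) := rfl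

theorem induction {P : TruncatedSymmetricAlgebra K L p → Prop}
    (algebraMap : ∀ r : K, P (algebraMap K _ r)) (ι : ∀ x, P (ι K L p x))
    (mul : ∀ a b, P a → P b → P (a * b)) (add : ∀ a b, P a → P b → P (a + b))
    (a : TruncatedSymmetricAlgebra K L p) : P a := by
  obtain ⟨a, rfl⟩ := Ideal.Quotient.mkₐ_surjective K _ a
  induction a using SymmetricAlgebra.induction with
  | algebraMap r => rw [AlgHom.commutes]; exact algebraMap r
  | ι x => exact ι x
  | mul a b ha hb => rw [map_mul]; exact mul _ _ ha hb
  | add a b ha hb => rw [map_add]; exact add _ _ ha hb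

theorem ι_pow_eq_zero (x : L) : ι K L p x ^ p = 0 := by
  rw [ι_apply, ← map_pow]
  exact Ideal.Quotient.eq_zero_iff_mem.2 (Ideal.subset_span ⟨x, rfl⟩)

/-- The universal property of the truncated symmetric algebra. -/
def lift {B : Type*} [CommRing B] [Algebra K B] (f : L →ₗ[K] B) (hf : ∀ x, f x ^ p = 0) :
    TruncatedSymmetricAlgebra K L p →ₐ[K] B :=
  Ideal.Quotient.liftₐ (truncIdeal K L p) (SymmetricAlgebra.lift f) fun a ha => by
    suffices h : truncIdeal K L p ≤ RingHom.ker (SymmetricAlgebra.lift f) from h ha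
    refine Ideal.span_le.2 ?_
    rintro _ ⟨v, rfl⟩
    rw [SetLike.mem_coe, RingHom.mem_ker, map_pow, SymmetricAlgebra.lift_ι_apply, hf]

theorem lift_ι {B : Type*} [CommRing B] [Algebra K B] (f : L →ₗ[K] B) (hf : ∀ x, f x ^ p = 0)
    (x : L) : lift f hf (ι K L p x) = f x := by
  rw [ι_apply, lift]
  exact SymmetricAlgebra.lift_ι_apply ..

end Lift

section Linear

variable {K L : Type*} [CommRing K] [LieRing L] [LieAlgebra K L] {p : ℕ}
  [Module Kᵐᵒᵖ L] [IsCentralScalar K L]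

/-- The projection of `s(L)` to its components of degree `0` and `1`. -/
def toTrivSqZeroExt (hp : 2 ≤ p) : TruncatedSymmetricAlgebra K L p →ₐ[K] TrivSqZeroExt K L :=
  lift (TrivSqZeroExt.inrHom K L) fun x => by
    obtain ⟨k, rfl⟩ := Nat.exists_eq_add_of_le hp
    rw [pow_add, pow_two, TrivSqZeroExt.inrHom_apply, TrivSqZeroExt.inr_mul_inr, zero_mul]

theorem toTrivSqZeroExt_ι (hp : 2 ≤ p) (x : L) :
    toTrivSqZeroExt hp (ι K L p x) = TrivSqZeroExt.inr x := lift_ι ..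

theorem ι_injective (hp : 2 ≤ p) : Function.Injective (ι K L p) := by
  intro x y h
  have := congrArg (toTrivSqZeroExt hp) h
  rw [toTrivSqZeroExt_ι, toTrivSqZeroExt_ι] at this
  exact TrivSqZeroExt.inr_injective this

end Linear

section Poisson

open PoissonAlgebra

variable {K L : Type*} [CommRing K] [LieRing L] [LieAlgebra K L] {p : ℕ} [CharP K p]

theorem mk_bracket (a b : SymmetricAlgebra K L) :
    Ideal.Quotient.mkₐ K (truncIdeal K L p) (bracket (K := K) a b) =
      bracket (K := K) (Ideal.Quotient.mkₐ K (truncIdeal K L p) a)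
        (Ideal.Quotient.mkₐ K (truncIdeal K L p) b) := rfl

theorem bracket_ι_ι (x y : L) :
    bracket (K := K) (ι K L p x) (ι K L p y) = ι K L p ⁅x, y⁆ := by
  rw [ι_apply, ι_apply, ← mk_bracket, SymmetricAlgebra.bracket_ι_ι, ι_apply]

theorem ι_mem_gamma (n : ℕ) {x : L} (hx : x ∈ lieGamma K L n) :
    ι K L p x ∈ gamma K (TruncatedSymmetricAlgebra K L p) n := by
  induction n generalizing x with
  | zero => exact Submodule.mem_top
  | succ n ih =>
    rw [lieGamma_succ] at hx
    induction hx using Submodule.span_induction with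
    | mem x hx =>
      obtain ⟨a, ha, y, rfl⟩ := hx
      rw [← bracket_ι_ι]
      exact bracket_mem_gamma_succ (ih ha) _
    | zero => rw [map_zero]; exact zero_mem _
    | add x y _ _ hx hy => rw [map_add]; exact add_mem hx hy
    | smul c x _ hx => rw [map_smul]; exact Submodule.smul_mem _ _ hx

theorem bracket_mem_of_forall_ι {I : Ideal (TruncatedSymmetricAlgebra K L p)}
    {a : TruncatedSymmetricAlgebra K L p} (h : ∀ y, bracket (K := K) a (ι K L p y) ∈ I)
    (b : TruncatedSymmetricAlgebra K L p) : bracket (K := K) a b ∈ I := by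
  induction b using TruncatedSymmetricAlgebra.induction with
  | algebraMap r => rw [bracket_algebraMap_right]; exact zero_mem _
  | ι y => exact h y
  | mul b c hb hc =>
    rw [leibniz_right]
    exact add_mem (Ideal.mul_mem_left _ _ hc) (Ideal.mul_mem_left _ _ hb)
  | add b c hb hc => rw [map_add]; exact add_mem hb hc

variable [Module Kᵐᵒᵖ L] [IsCentralScalar K L]

/-- Constants are central, and Leibniz sends elements without terms of degree below two to elements
of the same kind; thus only the linear parts survive. -/
theorem toTrivSqZeroExt_bracket (hp : 2 ≤ p) (a b : TruncatedSymmetricAlgebra K L p) :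
    toTrivSqZeroExt hp (bracket (K := K) a b) =
      TrivSqZeroExt.inr ⁅(toTrivSqZeroExt hp a).snd, (toTrivSqZeroExt hp b).snd⁆ := by
  induction a using TruncatedSymmetricAlgebra.induction with
  | algebraMap r =>
    rw [bracket_algebraMap_left, AlgHom.commutes, map_zero, TrivSqZeroExt.algebraMap_eq_inl,
      TrivSqZeroExt.snd_inl, zero_lie, TrivSqZeroExt.inr_zero]
  | ι x =>
    induction b using TruncatedSymmetricAlgebra.induction with
    | algebraMap r =>
      rw [bracket_algebraMap_right, AlgHom.commutes, map_zero, TrivSqZeroExt.algebraMap_eq_inl,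
        TrivSqZeroExt.snd_inl, lie_zero, TrivSqZeroExt.inr_zero]
    | ι y => simp [bracket_ι_ι, toTrivSqZeroExt_ι]
    | mul b c hb hc =>
      rw [leibniz_right, map_add, map_mul, map_mul, map_mul, hb, hc]
      ext <;> simp
    | add b c hb hc => rw [map_add, map_add, map_add, hb, hc]; simp
  | mul a c ha hc =>
    rw [leibniz, map_add, map_mul, map_mul, map_mul, ha, hc]
    ext <;> simp
  | add a c ha hc => rw [map_add, LinearMap.add_apply, map_add, map_add, ha, hc]; simp

/-- The vanishing constant term keeps the induction alive under multiplication: the linear part of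
`c * x` is then a scalar multiple of that of `x`. -/
theorem toTrivSqZeroExt_of_mem_upperPower (hp : 2 ≤ p) (n : ℕ)
    {a : TruncatedSymmetricAlgebra K L p}
    (ha : a ∈ upperPower K (TruncatedSymmetricAlgebra K L p) n) :
    (toTrivSqZeroExt hp a).snd ∈ lieGamma K L n ∧ (1 ≤ n → (toTrivSqZeroExt hp a).fst = 0) := by
  induction n generalizing a with
  | zero => exact ⟨trivial, fun h => absurd h (by norm_num)⟩
  | succ n ih =>
    induction ha using Submodule.span_induction with
    | mem x hx =>
      obtain ⟨a, ha, b, rfl⟩ := hx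
      rw [toTrivSqZeroExt_bracket]
      exact ⟨by simpa using lie_mem_lieGamma_succ (ih ha).1 _, fun _ => by simp⟩
    | zero => simp
    | add x y _ _ hx hy =>
      rw [map_add]
      exact ⟨add_mem hx.1 hy.1, fun h => by rw [TrivSqZeroExt.fst_add, hx.2 h, hy.2 h, add_zero]⟩
    | smul c x _ hx =>
      rw [smul_eq_mul, map_mul]
      have h0 := hx.2 (Nat.succ_pos n)
      refine ⟨?_, fun h => by rw [TrivSqZeroExt.fst_mul, h0, mul_zero]⟩
      rw [TrivSqZeroExt.snd_mul, h0, MulOpposite.op_zero, zero_smul, add_zero]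
      exact Submodule.smul_mem _ _ hx.1

end Poisson

end TruncatedSymmetricAlgebra

section Dimension

variable {K L : Type*} [CommRing K] [LieRing L] [LieAlgebra K L]

theorem lieGamma_le_poissonDimension (n : ℕ) : lieGamma K L n ≤ poissonDimension K L n :=
  fun _ hx => SymmetricAlgebra.ι_mem_upperPower n hx

theorem poissonDimension_le_truncatedPoissonDimension (p : ℕ) [CharP K p] (n : ℕ) :
    poissonDimension K L n ≤ truncatedPoissonDimension K L p n := fun _ hx =>
  PoissonAlgebra.map_mem_upperPower (Ideal.Quotient.mkₐ K (truncIdeal K L p))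
    TruncatedSymmetricAlgebra.mk_bracket n hx

theorem truncatedPoissonDimension_le_lieGamma {p : ℕ} [CharP K p] (hp : 2 ≤ p) (n : ℕ) :
    truncatedPoissonDimension K L p n ≤ lieGamma K L n := fun x hx => by
  -- The square-zero extension asks for a right action, which here is the left one.
  let _ : Module Kᵐᵒᵖ L := Module.compHom _ ((RingHom.id K).fromOpposite mul_comm)
  have _ : IsCentralScalar K L := ⟨fun _ _ => rfl⟩
  have h := (TruncatedSymmetricAlgebra.toTrivSqZeroExt_of_mem_upperPower hp n hx).1
  rwa [TruncatedSymmetricAlgebra.toTrivSqZeroExt_ι, TrivSqZeroExt.snd_inr] at h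

theorem TruncatedSymmetricAlgebra.eq_zero_of_ι_eq_zero {p : ℕ} (hp : 2 ≤ p) {x : L}
    (hx : ι K L p x = 0) : x = 0 := by
  let _ : Module Kᵐᵒᵖ L := Module.compHom _ ((RingHom.id K).fromOpposite mul_comm)
  have _ : IsCentralScalar K L := ⟨fun _ _ => rfl⟩
  exact ι_injective hp (hx.trans (map_zero _).symm)

end Dimension

/-! ### Nonvanishing of truncated monomials -/

section TruncatedPolynomial

variable (σ K : Type*) [Field K] (p : ℕ)

/-- The ideal of a polynomial ring generated by the `p`-th powers of the variables. -/
noncomputable def powVarIdeal : Ideal (MvPolynomial σ K) :=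
  Ideal.span (Set.range fun i => MvPolynomial.X i ^ p)

variable {σ K p}

theorem prod_X_pow_notMem_powVarIdeal [Fintype σ] {a : σ → ℕ} (ha : ∀ i, a i < p) :
    ∏ i, MvPolynomial.X i ^ a i ∉ powVarIdeal σ K p := by
  classical
  have h1 : powVarIdeal σ K p = Ideal.span ((fun s => MvPolynomial.monomial s (1 : K)) ''
      Set.range fun i => Finsupp.single i p) := by
    rw [powVarIdeal, ← Set.range_comp]
    congr 2
    funext i
    exact MvPolynomial.X_pow_eq_monomial
  have h2 : ∏ i, (MvPolynomial.X i : MvPolynomial σ K) ^ a i =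
      MvPolynomial.monomial (Finsupp.equivFunOnFinite.symm a) 1 := by
    rw [MvPolynomial.monomial_eq, Finsupp.prod_fintype _ _ (by simp)]
    simp
  rw [h1, h2, MvPolynomial.mem_ideal_span_monomial_image]
  intro h
  obtain ⟨_, ⟨i, rfl⟩, hi⟩ := h (Finsupp.equivFunOnFinite.symm a) (by
    rw [MvPolynomial.support_monomial, if_neg one_ne_zero, Finset.mem_singleton])
  have := hi i
  rw [Finsupp.single_eq_same] at this
  exact absurd (ha i) (not_lt.2 this)

end TruncatedPolynomial

namespace TruncatedSymmetricAlgebra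

open PoissonAlgebra

section Independent

variable {K L V : Type*} [Field K] [AddCommGroup L] [Module K L] [AddCommGroup V] [Module K V]
  {p : ℕ} [Fact p.Prime] [CharP K p]

/-- A linear left inverse reads off coordinates along the vectors `π (e i)`. In characteristic p the
p-th power is additive, so every linear form in the variables has zero p-th power in the target, and
the map extends to s(L). Allowing `π` to be a quotient map gives nonvanishing modulo an ideal. -/
theorem exists_algHom_powVarIdeal {σ : Type*} [Fintype σ] (π : L →ₗ[K] V) (e : σ → L)
    (he : LinearIndependent K (π ∘ e)) :
    ∃ χ : TruncatedSymmetricAlgebra K L p →ₐ[K] (MvPolynomial σ K ⧸ powVarIdeal σ K p),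
      (∀ x, π x = 0 → χ (ι K L p x) = 0) ∧
        ∀ i, χ (ι K L p (e i)) = Ideal.Quotient.mkₐ K (powVarIdeal σ K p) (MvPolynomial.X i) := by
  classical
  obtain ⟨g, hg⟩ := LinearMap.exists_leftInverse_of_injective
    (Finsupp.linearCombination K (π ∘ e)) (LinearMap.ker_eq_bot.2 he)
  let f : L →ₗ[K] (MvPolynomial σ K ⧸ powVarIdeal σ K p) :=
    (Ideal.Quotient.mkₐ K (powVarIdeal σ K p)).toLinearMap ∘ₗ
      Finsupp.linearCombination K MvPolynomial.X ∘ₗ g ∘ₗ π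
  have hf : ∀ x, f x ^ p = 0 := by
    intro x
    change (Ideal.Quotient.mkₐ K (powVarIdeal σ K p))
      (Finsupp.linearCombination K MvPolynomial.X (g (π x))) ^ p = 0
    rw [← map_pow]
    refine Ideal.Quotient.eq_zero_iff_mem.2 ?_
    rw [Finsupp.linearCombination_apply, Finsupp.sum, sum_pow_char]
    refine Ideal.sum_mem _ fun i _ => ?_
    rw [smul_pow]
    exact Submodule.smul_of_tower_mem _ _ (Ideal.subset_span ⟨i, rfl⟩)
  refine ⟨lift f hf, fun x hx => ?_, fun i => ?_⟩
  · rw [lift_ι]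
    simp [f, hx]
  · rw [lift_ι]
    have h1 : g (π (e i)) = Finsupp.single i 1 := by
      have := LinearMap.congr_fun hg (Finsupp.single i 1)
      simpa using this
    simp [f, h1]

theorem prod_ι_pow_ne_zero {σ : Type*} [Fintype σ] {e : σ → L} (he : LinearIndependent K e)
    {a : σ → ℕ} (ha : ∀ i, a i < p) : ∏ i, ι K L p (e i) ^ a i ≠ 0 := by
  intro h
  obtain ⟨χ, -, hχ⟩ := exists_algHom_powVarIdeal (p := p) (LinearMap.id (R := K) (M := L)) e he
  apply prod_X_pow_notMem_powVarIdeal (K := K) ha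
  refine Ideal.Quotient.eq_zero_iff_mem.1 ?_
  have h' := congrArg χ h
  rw [map_zero, map_prod] at h'
  simp only [map_pow, hχ] at h'
  rw [← h']
  simp

end Independent

end TruncatedSymmetricAlgebra

/-! ### Finite dimensionality of the lower central factors -/

section LinearAlgebra

variable {K L V : Type*} [Field K] [AddCommGroup L] [Module K L] [AddCommGroup V] [Module K V]

/-- If the values `B x y` with `x ∈ U` do not span a finite dimensional space, then one can choose
successive `x ∈ U`, each orthogonal to the preceding one, with new values `B x y`. -/
theorem exists_orthogonal_step (B : L →ₗ[K] L →ₗ[K] V) (hB : ∀ x, B x x = 0) (U : Submodule K L)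
    (hU : ¬ FiniteDimensional K (Submodule.span K {z | ∃ x ∈ U, ∃ y, z = B x y})) :
    ∃ G : Set L, G.Nonempty ∧ G ⊆ U ∧ ∀ x ∈ G, ∀ W : Submodule K V, FiniteDimensional K W →
      ∃ x' ∈ G, B x x' = 0 ∧ ∃ y, B x' y ∉ W := by
  by_cases hA : ∃ x ∈ U, ¬ FiniteDimensional K (LinearMap.range (B x))
  · obtain ⟨x, hx, hr⟩ := hA
    refine ⟨{x}, ⟨x, rfl⟩, Set.singleton_subset_iff.2 hx, ?_⟩
    rintro _ rfl W hW
    refine ⟨_, rfl, hB _, ?_⟩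
    by_contra! h
    apply hr
    refine Submodule.finiteDimensional_of_le (S₂ := W) ?_
    rintro _ ⟨y, rfl⟩
    exact h y
  push Not at hA
  refine ⟨U, ⟨0, U.zero_mem⟩, subset_rfl, fun x hx W hW => ?_⟩
  by_contra! h
  apply hU
  have := hA x hx
  let f : U →ₗ[K] V := (B x).domRestrict U
  -- The kernel of `B x` on `U` has a finite-dimensional complement, which contributes only finitely
  -- many dimensions of values. If the kernel contributed values in `W` alone, all values would span
  -- a finite-dimensional space.
  obtain ⟨D, hD⟩ := (LinearMap.ker f).exists_isCompl
  have : FiniteDimensional K (LinearMap.range f) :=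
    Submodule.finiteDimensional_of_le (S₂ := LinearMap.range (B x)) (by
      rintro _ ⟨u, rfl⟩
      exact ⟨u, rfl⟩)
  have : FiniteDimensional K D :=
    Module.Finite.equiv (f.quotKerEquivRange.symm.trans (Submodule.quotientEquivOfIsCompl _ _ hD))
  obtain ⟨s, hs⟩ := (Module.Finite.iff_fg (N := D)).1 this
  have hfin : ∀ d ∈ s, FiniteDimensional K (LinearMap.range (B (d : L))) := fun d _ => hA d d.2
  have : FiniteDimensional K (s.sup fun d : U => LinearMap.range (B (d : L)) : Submodule K V) := by
    rw [Finset.sup_eq_iSup, iSup_subtype']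
    have : ∀ i : { d // d ∈ s }, FiniteDimensional K (LinearMap.range (B ((i : U) : L))) :=
      fun i => hfin i i.2
    infer_instance
  refine Submodule.finiteDimensional_of_le
    (S₂ := W ⊔ s.sup fun d : U => LinearMap.range (B (d : L))) ?_
  rw [Submodule.span_le]
  rintro _ ⟨u, hu, y, rfl⟩
  obtain ⟨c, hc, d, hd, hcd⟩ := Submodule.mem_sup.1
    (show (⟨u, hu⟩ : U) ∈ LinearMap.ker f ⊔ D by rw [hD.sup_eq_top]; trivial)
  have hu' : u = (c : L) + (d : L) := by rw [← Submodule.coe_add, hcd]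
  rw [hu', map_add, LinearMap.add_apply]
  refine Submodule.add_mem_sup (h c c.2 hc y) ?_
  have key : D ≤ (s.sup fun d : U => LinearMap.range (B (d : L))).comap
      ((B.flip y).domRestrict U) := by
    rw [← hs, Submodule.span_le]
    exact fun d hd =>
      Finset.le_sup (f := fun d : U => LinearMap.range (B (d : L))) hd ⟨y, rfl⟩
  exact key hd

end LinearAlgebra

namespace TruncatedSymmetricAlgebra

open PoissonAlgebra

section FiniteDimensional

variable {K L : Type*} [Field K] [LieRing L] [LieAlgebra K L] {p : ℕ}

variable (K L p) in
/-- The ideal of `s(L)` generated by a term of the lower central series of `L`. -/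
def lieGammaIdeal (n : ℕ) : Ideal (TruncatedSymmetricAlgebra K L p) :=
  Ideal.span (ι K L p '' lieGamma K L n)

theorem ι_mem_lieGammaIdeal {n : ℕ} {x : L} (hx : x ∈ lieGamma K L n) :
    ι K L p x ∈ lieGammaIdeal K L p n :=
  Ideal.subset_span ⟨x, hx, rfl⟩

variable [CharP K p]

theorem bracket_ι_mem_lieGammaIdeal_succ {n : ℕ} {x : L} (hx : x ∈ lieGamma K L n)
    (b : TruncatedSymmetricAlgebra K L p) :
    bracket (K := K) (ι K L p x) b ∈ lieGammaIdeal K L p (n + 1) :=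
  bracket_mem_of_forall_ι (fun y => by
    rw [bracket_ι_ι]
    exact ι_mem_lieGammaIdeal (lie_mem_lieGamma_succ hx y)) b

theorem bracket_mem_lieGammaIdeal {n : ℕ} {a : TruncatedSymmetricAlgebra K L p}
    (ha : a ∈ lieGammaIdeal K L p n) (b : TruncatedSymmetricAlgebra K L p) :
    bracket (K := K) a b ∈ lieGammaIdeal K L p n := by
  induction ha using Submodule.span_induction with
  | mem x hx =>
    obtain ⟨x, hx, rfl⟩ := hx
    refine bracket_mem_of_forall_ι (fun y => ?_) b
    rw [bracket_ι_ι]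
    exact ι_mem_lieGammaIdeal (lieGamma_antitone n.le_succ (lie_mem_lieGamma_succ hx y))
  | zero => rw [map_zero, LinearMap.zero_apply]; exact zero_mem _
  | add x y _ _ hx hy => rw [map_add, LinearMap.add_apply]; exact add_mem hx hy
  | smul c x hx' hx =>
    rw [smul_eq_mul, leibniz]
    exact add_mem (Ideal.mul_mem_left _ _ hx) (Ideal.mul_mem_right _ _ hx')

theorem bracket_prod_mem {σ : Type*} (s : Finset σ) {I : Ideal (TruncatedSymmetricAlgebra K L p)}
    (a : σ → TruncatedSymmetricAlgebra K L p) (b : TruncatedSymmetricAlgebra K L p)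
    (h : ∀ i ∈ s, bracket (K := K) (a i) b ∈ I) : bracket (K := K) (∏ i ∈ s, a i) b ∈ I := by
  classical
  induction s using Finset.induction_on with
  | empty =>
    rw [Finset.prod_empty, ← map_one (algebraMap K _), bracket_algebraMap_left]
    exact zero_mem _
  | insert i s hi ih =>
    rw [Finset.prod_insert hi, leibniz]
    exact add_mem (Ideal.mul_mem_left _ _ (ih fun j hj => h j (Finset.mem_insert_of_mem hj)))
      (Ideal.mul_mem_left _ _ (h i (Finset.mem_insert_self i s)))

/-- Otherwise choose x_i, y_i with {x_i, x_{i+1}} negligible and z_i = [x_i, y_i] independent modulo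
the next term. Starting from x_0 and bracketing successively with y_i x_{i+1} gives z_0⋯z_{m-1} x_m
modulo `I`, a nonzero element as deep as desired. -/
theorem finiteDimensional_of_gamma_eq_bot [Fact p.Prime] {k : ℕ}
    (hk : gamma K (TruncatedSymmetricAlgebra K L p) k = ⊥) (n : ℕ) :
    FiniteDimensional K ((lieGamma K L (n + 1)).map (lieGamma K L (n + 2)).mkQ) := by
  set π := (lieGamma K L (n + 2)).mkQ with hπ
  let B : L →ₗ[K] L →ₗ[K] (L ⧸ lieGamma K L (n + 2)) :=
    LinearMap.mk₂ K (fun x y => π ⁅x, y⁆) (by intros; simp) (by intros; simp) (by intros; simp)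
      (by intros; simp)
  have hBapp : ∀ x y, B x y = π ⁅x, y⁆ := fun x y => rfl
  have hspan : (lieGamma K L (n + 1)).map π =
      Submodule.span K {z | ∃ x ∈ lieGamma K L n, ∃ y, z = B x y} := by
    rw [lieGamma_succ n, Submodule.map_span]
    congr 1
    ext z
    constructor
    · rintro ⟨_, ⟨x, hx, y, rfl⟩, rfl⟩
      exact ⟨x, hx, y, rfl⟩
    · rintro ⟨x, hx, y, rfl⟩
      exact ⟨_, ⟨x, hx, y, rfl⟩, rfl⟩
  rw [hspan]
  by_contra hinf
  obtain ⟨G, ⟨x₀, hx₀⟩, hGU, hG⟩ := exists_orthogonal_step B (fun x => by simp [hBapp])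
    (lieGamma K L n) hinf
  let I := lieGammaIdeal K L p (n + 2)
  -- The last commutator `⁅x, y⁆` is chosen already but not yet a factor of `u`; the next bracket,
  -- with a multiple of `y`, releases it.
  have step : ∀ m : ℕ, ∃ z : Fin (m + 1) → L, ∃ x ∈ G, ∃ y, z (Fin.last m) = ⁅x, y⁆ ∧
      LinearIndependent K (π ∘ z) ∧ (∀ i, z i ∈ lieGamma K L (n + 1)) ∧
      ∃ u ∈ gamma K (TruncatedSymmetricAlgebra K L p) m,
        u - ι K L p x * ∏ i : Fin m, ι K L p (z i.castSucc) ∈ I := by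
    intro m
    induction m with
    | zero =>
      obtain ⟨x, hx, -, y, hy⟩ := hG x₀ hx₀ ⊥ inferInstance
      refine ⟨fun _ => ⁅x, y⁆, x, hx, y, rfl, ?_, fun _ => lie_mem_lieGamma_succ (hGU hx) y,
        ι K L p x, Submodule.mem_top, by simp⟩
      have : Unique (Fin (0 + 1)) := inferInstanceAs (Unique (Fin 1))
      rw [linearIndependent_unique_iff]
      exact fun h => hy (by rw [hBapp]; exact h)
    | succ m ih =>
      obtain ⟨z, x, hx, y, hz, hli, hzm, u, hu, hux⟩ := ih
      obtain ⟨x', hx', hxx', y', hy'⟩ := hG x hx (Submodule.span K (Set.range (π ∘ z)))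
        (FiniteDimensional.span_of_finite K (Set.finite_range _))
      have hxx : ⁅x, x'⁆ ∈ lieGamma K L (n + 2) := by
        rw [hBapp, hπ, Submodule.mkQ_apply, Submodule.Quotient.mk_eq_zero] at hxx'
        exact hxx'
      refine ⟨Fin.snoc z ⁅x', y'⁆, x', hx', y', by simp, ?_, ?_,
        bracket (K := K) u (ι K L p y * ι K L p x'), bracket_mem_gamma_succ hu _, ?_⟩
      · have : π ∘ (Fin.snoc z ⁅x', y'⁆ : Fin (m + 1 + 1) → L) =
            (Fin.snoc (π ∘ z) (π ⁅x', y'⁆) : Fin (m + 1 + 1) → _) := Fin.comp_snoc ..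
        rw [this, linearIndependent_finSnoc]
        exact ⟨hli, hy'⟩
      · intro i
        refine Fin.lastCases ?_ (fun i => ?_) i
        · rw [Fin.snoc_last]; exact lie_mem_lieGamma_succ (hGU hx') y'
        · rw [Fin.snoc_castSucc]; exact hzm i
      · simp only [Fin.snoc_castSucc]
        rw [Fin.prod_univ_castSucc, hz]
        set w := ∏ i : Fin m, ι K L p (z i.castSucc) with hw
        have h1 := bracket_mem_lieGammaIdeal hux (ι K L p y * ι K L p x')
        have h2 : bracket (K := K) w (ι K L p y * ι K L p x') ∈ I :=
          bracket_prod_mem _ _ _ fun i _ => bracket_ι_mem_lieGammaIdeal_succ (hzm _) _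
        have h3 : ι K L p ⁅x, x'⁆ ∈ I := ι_mem_lieGammaIdeal hxx
        rw [map_sub, LinearMap.sub_apply, leibniz, leibniz_right (ι K L p x), bracket_ι_ι,
          bracket_ι_ι] at h1
        have h4 := add_mem (add_mem h1 (Ideal.mul_mem_left _ (ι K L p x) h2))
          (Ideal.mul_mem_left _ (w * ι K L p y) h3)
        convert h4 using 1
        ring
  obtain ⟨z, x, hx, y, hz, hli, hzm, u, hu, hux⟩ := step k
  rw [hk, Submodule.mem_bot] at hu
  -- A final bracket with `y` alone turns the remaining `x` into the last commutator, while `u = 0`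
  -- puts the full product in `I`.
  have h1 := bracket_mem_lieGammaIdeal hux (ι K L p y)
  have h2 : bracket (K := K) (∏ i : Fin k, ι K L p (z i.castSucc)) (ι K L p y) ∈ I :=
    bracket_prod_mem _ _ _ fun i _ => bracket_ι_mem_lieGammaIdeal_succ (hzm _) _
  rw [hu, zero_sub, map_neg, LinearMap.neg_apply, neg_mem_iff, leibniz, bracket_ι_ι, ← hz] at h1
  have h3 := (add_mem_cancel_left (Ideal.mul_mem_left _ _ h2)).1 h1
  rw [← Fin.prod_univ_castSucc (fun i => ι K L p (z i))] at h3
  obtain ⟨χ, hχ0, hχ⟩ := exists_algHom_powVarIdeal (p := p) π z hli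
  have hI : I ≤ RingHom.ker χ := by
    refine Ideal.span_le.2 ?_
    rintro _ ⟨v, hv, rfl⟩
    exact hχ0 v ((Submodule.Quotient.mk_eq_zero _).2 hv)
  have h4 : χ (∏ i, ι K L p (z i)) = 0 := hI h3
  rw [map_prod] at h4
  simp only [hχ] at h4
  refine prod_X_pow_notMem_powVarIdeal (K := K) (p := p) (σ := Fin (k + 1)) (a := fun _ => 1)
    (fun _ => (Fact.out : p.Prime).one_lt) (Ideal.Quotient.eq_zero_iff_mem.1 ?_)
  rw [← h4]
  simp

theorem finite_lieGammaFactor_of_gamma_eq_bot [Fact p.Prime] {k : ℕ}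
    (hk : gamma K (TruncatedSymmetricAlgebra K L p) k = ⊥) (n : ℕ) :
    Module.Finite K (LieGammaFactor K L (n + 1)) := by
  have := finiteDimensional_of_gamma_eq_bot hk n
  let f : LieGammaFactor K L (n + 1) →ₗ[K] L ⧸ lieGamma K L (n + 2) :=
    Submodule.mapQ _ _ (lieGamma K L (n + 1)).subtype le_rfl
  have hinj : Function.Injective f := by
    rw [injective_iff_map_eq_zero]
    intro v hv
    obtain ⟨v, rfl⟩ := Submodule.Quotient.mk_surjective _ v
    have hv' : (Submodule.Quotient.mk (v : L) : L ⧸ lieGamma K L (n + 2)) = 0 := hv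
    have hv'' : (v : L) ∈ lieGamma K L (n + 2) := (Submodule.Quotient.mk_eq_zero _).1 hv'
    exact (Submodule.Quotient.mk_eq_zero _).2 hv''
  have hrange : ∀ v, f v ∈ (lieGamma K L (n + 1)).map (lieGamma K L (n + 2)).mkQ := by
    intro v
    obtain ⟨v, rfl⟩ := Submodule.Quotient.mk_surjective _ v
    exact ⟨v, v.2, rfl⟩
  exact Module.Finite.of_injective (f.codRestrict _ hrange)
    fun _ _ h => hinj (congrArg Subtype.val h)

end FiniteDimensional

end TruncatedSymmetricAlgebra

/-! ### Weight filtration and bounds for both classes -/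

namespace TruncatedSymmetricAlgebra

open PoissonAlgebra

section MonomialIdeal

variable {K L : Type*} [Field K] [LieRing L] [LieAlgebra K L] {σ : Type*} [Fintype σ]

variable (K) in
/-- The ideal of `s(L)` generated by the monomials of weight at least `m` in elements `e s` of
weight `wt s`. -/
def monomialIdeal (p : ℕ) (e : σ → L) (wt : σ → ℕ) (m : ℕ) :
    Ideal (TruncatedSymmetricAlgebra K L p) :=
  Ideal.span {a | ∃ α : σ → ℕ, m ≤ ∑ s, α s * wt s ∧ a = ∏ s, ι K L p (e s) ^ α s}

variable {p : ℕ} {e : σ → L} {wt : σ → ℕ}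

theorem monomialIdeal_antitone : Antitone (monomialIdeal K p e wt) := fun _ _ h =>
  Ideal.span_mono fun _ ⟨α, hα, ha⟩ => ⟨α, h.trans hα, ha⟩

theorem one_mem_monomialIdeal : 1 ∈ monomialIdeal K p e wt 0 :=
  Ideal.subset_span ⟨0, by simp, by simp⟩

theorem mul_mem_monomialIdeal {m n : ℕ} {a b : TruncatedSymmetricAlgebra K L p}
    (ha : a ∈ monomialIdeal K p e wt m) (hb : b ∈ monomialIdeal K p e wt n) :
    a * b ∈ monomialIdeal K p e wt (m + n) := by
  have h := Ideal.mul_mem_mul ha hb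
  rw [monomialIdeal, monomialIdeal, Ideal.span_mul_span'] at h
  refine Ideal.span_mono ?_ h
  rintro _ ⟨_, ⟨α, hα, rfl⟩, _, ⟨β, hβ, rfl⟩, rfl⟩
  refine ⟨α + β, ?_, ?_⟩
  · simp only [Pi.add_apply, add_mul, Finset.sum_add_distrib]
    exact add_le_add hα hβ
  · simp only [Pi.add_apply, pow_add, Finset.prod_mul_distrib]

theorem ι_mem_monomialIdeal
    (hspan : ∀ n ≥ 1, lieGamma K L n ≤ Submodule.span K (e '' {s | n ≤ wt s})) {n : ℕ} {x : L}
    (hx : x ∈ lieGamma K L n) : ι K L p x ∈ monomialIdeal K p e wt n := by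
  classical
  rcases n.eq_zero_or_pos with rfl | hn
  · rw [(Ideal.eq_top_iff_one _).2 one_mem_monomialIdeal]
    exact Submodule.mem_top
  replace hx := hspan n hn hx
  induction hx using Submodule.span_induction with
  | mem x hx =>
    obtain ⟨s, hs, rfl⟩ := hx
    refine Ideal.subset_span ⟨Pi.single s 1, ?_, ?_⟩
    · rw [Fintype.sum_eq_single s fun t ht => by rw [Pi.single_eq_of_ne ht, zero_mul]]
      simpa using hs
    · rw [Fintype.prod_eq_single s fun t ht => by rw [Pi.single_eq_of_ne ht, pow_zero]]
      simp
  | zero => rw [map_zero]; exact zero_mem _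
  | add x y _ _ hx hy => rw [map_add]; exact add_mem hx hy
  | smul c x _ hx => rw [map_smul]; exact Submodule.smul_of_tower_mem _ _ hx

variable [CharP K p]

theorem bracket_mem_monomialIdeal_one
    (hspan : ∀ n ≥ 1, lieGamma K L n ≤ Submodule.span K (e '' {s | n ≤ wt s}))
    (a b : TruncatedSymmetricAlgebra K L p) :
    bracket (K := K) a b ∈ monomialIdeal K p e wt 1 := by
  refine bracket_mem_of_forall_ι (fun y => ?_) b
  rw [bracket_skew, neg_mem_iff]
  refine bracket_mem_of_forall_ι (fun x => ?_) a
  rw [bracket_ι_ι]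
  exact ι_mem_monomialIdeal hspan (lie_mem_lieGamma_succ (n := 0) trivial x)

/-- Each `e s` gains weight under brackets, and by Leibniz so does every monomial. Arbitrary
coefficients cause no loss, since their brackets already have weight one, coming from [L, L]. -/
theorem bracket_mem_monomialIdeal_succ
    (hspan : ∀ n ≥ 1, lieGamma K L n ≤ Submodule.span K (e '' {s | n ≤ wt s}))
    (he : ∀ s, e s ∈ lieGamma K L (wt s)) {m : ℕ} {a : TruncatedSymmetricAlgebra K L p}
    (ha : a ∈ monomialIdeal K p e wt m) (b : TruncatedSymmetricAlgebra K L p) :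
    bracket (K := K) a b ∈ monomialIdeal K p e wt (m + 1) := by
  classical
  let Good : ℕ → TruncatedSymmetricAlgebra K L p → Prop := fun k a =>
    a ∈ monomialIdeal K p e wt k ∧ bracket (K := K) a b ∈ monomialIdeal K p e wt (k + 1)
  have hone : Good 0 1 := ⟨one_mem_monomialIdeal, by
    
    rw [← map_one (algebraMap K (TruncatedSymmetricAlgebra K L p)), bracket_algebraMap_left]
    exact zero_mem _⟩
  have hmul : ∀ k l a c, Good k a → Good l c → Good (k + l) (a * c) := by
    intro k l a c ha hc
    refine ⟨mul_mem_monomialIdeal ha.1 hc.1, ?_⟩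
    rw [leibniz]
    have h1 := mul_mem_monomialIdeal ha.1 hc.2
    have h2 := mul_mem_monomialIdeal hc.1 ha.2
    rw [show l + (k + 1) = k + l + 1 by ring] at h2
    exact add_mem h1 h2
  have hι : ∀ s, Good (wt s) (ι K L p (e s)) := fun s =>
    ⟨ι_mem_monomialIdeal hspan (he s), bracket_mem_of_forall_ι (fun y => by
      rw [bracket_ι_ι]
      exact ι_mem_monomialIdeal hspan (lie_mem_lieGamma_succ (he s) y)) b⟩
  have hpow : ∀ s (n : ℕ), Good (n * wt s) (ι K L p (e s) ^ n) := by
    intro s n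
    induction n with
    | zero => simpa using hone
    | succ n ih => rw [add_mul, one_mul, pow_succ]; exact hmul _ _ _ _ ih (hι s)
  have hprod : ∀ (α : σ → ℕ) (t : Finset σ),
      Good (∑ s ∈ t, α s * wt s) (∏ s ∈ t, ι K L p (e s) ^ α s) := by
    intro α t
    induction t using Finset.induction_on with
    | empty => simpa using hone
    | insert i t hi ih =>
      rw [Finset.prod_insert hi, Finset.sum_insert hi]
      exact hmul _ _ _ _ (hpow i _) ih
  induction ha using Submodule.span_induction with
  | mem x hx =>
    obtain ⟨α, hα, rfl⟩ := hx
    exact monomialIdeal_antitone (Nat.succ_le_succ hα) (hprod α Finset.univ).2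
  | zero => rw [map_zero, LinearMap.zero_apply]; exact zero_mem _
  | add x y _ _ hx hy => rw [map_add, LinearMap.add_apply]; exact add_mem hx hy
  | smul c x hx' hx =>
    rw [smul_eq_mul, leibniz]
    exact add_mem (Ideal.mul_mem_left _ _ hx)
      (mul_mem_monomialIdeal hx' (bracket_mem_monomialIdeal_one hspan c b))

theorem upperPower_le_monomialIdeal
    (hspan : ∀ n ≥ 1, lieGamma K L n ≤ Submodule.span K (e '' {s | n ≤ wt s}))
    (he : ∀ s, e s ∈ lieGamma K L (wt s)) (m : ℕ) :
    upperPower K (TruncatedSymmetricAlgebra K L p) m ≤ monomialIdeal K p e wt m := by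
  induction m with
  | zero => rw [(Ideal.eq_top_iff_one _).2 one_mem_monomialIdeal]; exact le_top
  | succ m ih =>
    refine Ideal.span_le.2 ?_
    rintro _ ⟨a, ha, b, rfl⟩
    exact bracket_mem_monomialIdeal_succ hspan he (ih ha) b

/-- A monomial with all exponents at most p-1 has weight at most (p-1) ∑ w_s; one unit more forces a
p-th power, which is zero. -/
theorem upperPower_eq_bot [Fact p.Prime]
    (hspan : ∀ n ≥ 1, lieGamma K L n ≤ Submodule.span K (e '' {s | n ≤ wt s}))
    (he : ∀ s, e s ∈ lieGamma K L (wt s)) :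
    upperPower K (TruncatedSymmetricAlgebra K L p) (1 + (p - 1) * ∑ s, wt s) = ⊥ := by
  refine eq_bot_iff.2 ((upperPower_le_monomialIdeal hspan he _).trans (Ideal.span_le.2 ?_))
  rintro _ ⟨α, hα, rfl⟩
  obtain ⟨s, hs⟩ : ∃ s, p ≤ α s := by
    by_contra! h
    have : ∑ s, α s * wt s ≤ (p - 1) * ∑ s, wt s := by
      rw [Finset.mul_sum]
      exact Finset.sum_le_sum fun s _ => Nat.mul_le_mul_right _ (Nat.le_sub_one_of_lt (h s))
    omega
  refine Finset.prod_eq_zero (Finset.mem_univ s) ?_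
  obtain ⟨k, hk⟩ := Nat.exists_eq_add_of_le hs
  rw [hk, pow_add, ι_pow_eq_zero, zero_mul]

theorem upperPower_ne_bot [Fact p.Prime] (hli : LinearIndependent K e)
    (he : ∀ s, e s ∈ lieGamma K L (wt s)) :
    upperPower K (TruncatedSymmetricAlgebra K L p) ((p - 1) * ∑ s, wt s) ≠ ⊥ := by
  intro h
  refine prod_ι_pow_ne_zero (p := p) hli (a := fun _ => p - 1)
    (fun _ => Nat.sub_lt (Fact.out : p.Prime).pos one_pos) ?_
  rw [← Ideal.mem_bot, ← h, Finset.mul_sum]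
  exact prod_mem_upperPower _ _ _ fun s _ =>
    pow_mem_upperPower (gamma_le_upperPower _ (ι_mem_gamma _ (he s))) _

/-- The bound p > 3 is used twice: 6 is invertible and p-1 is even. Since {x, y} is handled only for
actual brackets, each `e s` must be one commutator rather than a sum of them. -/
theorem gamma_ne_bot [Fact p.Prime] (hp : 3 < p) (hli : LinearIndependent K e)
    (he : ∀ s, ∃ n, wt s = n + 1 ∧ ∃ x ∈ lieGamma K L n, ∃ y, e s = ⁅x, y⁆) :
    gamma K (TruncatedSymmetricAlgebra K L p) ((p - 1) * ∑ s, wt s) ≠ ⊥ := by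
  have hpp : p.Prime := Fact.out
  have h6 : IsUnit (6 : K) := by
    refine IsUnit.mk0 _ fun h => ?_
    have h' : ((6 : ℕ) : K) = 0 := by exact_mod_cast h
    rw [CharP.cast_eq_zero_iff K p, show 6 = 2 * 3 by norm_num, hpp.dvd_mul] at h'
    rcases h' with h' | h' <;> have := Nat.le_of_dvd (by norm_num) h' <;> omega
  have heven : Even (p - 1) := hpp.even_sub_one (by omega)
  refine gammaIdeal_ne_bot fun h => ?_
  refine prod_ι_pow_ne_zero (p := p) hli (a := fun _ => p - 1)
    (fun _ => Nat.sub_lt hpp.pos one_pos) ?_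
  rw [← Ideal.mem_bot, ← h, Finset.mul_sum]
  refine prod_mem_gammaIdeal h6 _ _ _ (fun s _ => heven.mul_right _) fun s _ => ?_
  obtain ⟨n, hn, x, hx, y, hxy⟩ := he s
  rw [hn, hxy, ← bracket_ι_ι]
  exact bracket_pow_mem_gammaIdeal h6 heven (ι_mem_gamma n hx) _

end MonomialIdeal

end TruncatedSymmetricAlgebra

/-! ### Adapted bases consisting of commutators -/

section AdaptedBasis

variable {K L : Type*} [Field K] [LieRing L] [LieAlgebra K L]

theorem exists_lie_basis_lieGammaFactor (n : ℕ) [Module.Finite K (LieGammaFactor K L (n + 1))] :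
    ∃ b : Fin (Module.finrank K (LieGammaFactor K L (n + 1))) → L,
      (∀ i, ∃ x ∈ lieGamma K L n, ∃ y, b i = ⁅x, y⁆) ∧
        lieGamma K L (n + 1) ≤ Submodule.span K (Set.range b) ⊔ lieGamma K L (n + 2) := by
  let q : lieGamma K L (n + 1) →ₗ[K] LieGammaFactor K L (n + 1) := Submodule.mkQ _
  let s : Set (LieGammaFactor K L (n + 1)) :=
    {v | ∃ x ∈ lieGamma K L n, ∃ y, ∃ h : ⁅x, y⁆ ∈ lieGamma K L (n + 1), v = q ⟨⁅x, y⁆, h⟩}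
  have hs : Submodule.span K s = ⊤ := by
    have h1 : (Submodule.span K s).comap q = ⊤ := by
      have h2 : Submodule.span K {z : lieGamma K L (n + 1) |
          ∃ x ∈ lieGamma K L n, ∃ y, (z : L) = ⁅x, y⁆} = ⊤ := by
        apply Submodule.map_injective_of_injective (lieGamma K L (n + 1)).injective_subtype
        rw [Submodule.map_span, Submodule.map_top, Submodule.range_subtype]
        refine Eq.trans ?_ (lieGamma_succ n).symm
        congr 1
        ext z
        constructor
        · rintro ⟨z, ⟨x, hx, y, hz⟩, rfl⟩
          exact ⟨x, hx, y, hz⟩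
        · rintro ⟨x, hx, y, rfl⟩
          exact ⟨⟨_, lie_mem_lieGamma_succ hx y⟩, ⟨x, hx, y, rfl⟩, rfl⟩
      rw [eq_top_iff, ← h2, Submodule.span_le]
      rintro ⟨_, hz⟩ ⟨x, hx, y, rfl⟩
      exact Submodule.subset_span ⟨x, hx, y, hz, rfl⟩
    rw [eq_top_iff]
    intro v _
    obtain ⟨v, rfl⟩ := Submodule.mkQ_surjective _ v
    have : v ∈ (Submodule.span K s).comap q := by rw [h1]; trivial
    exact this
  have hfin : Module.Finite K (Submodule.span K s) := by rw [hs]; infer_instance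
  -- Commutators span the factor, so a basis can be extracted from their classes. Its independence
  -- is dropped here; a dimension count recovers it for the assembled family.
  obtain ⟨f, hfs, hf, -⟩ := Submodule.exists_fun_fin_finrank_span_eq K s
  have hcard : Module.finrank K (LieGammaFactor K L (n + 1)) =
      Module.finrank K (Submodule.span K s) := by rw [hs, finrank_top]
  choose x hx y hxy hfxy using hfs
  refine ⟨fun i => ⁅x (Fin.cast hcard i), y (Fin.cast hcard i)⁆, fun i => ⟨_, hx _, _, rfl⟩, ?_⟩
  intro v hv
  have h1 : q ⟨v, hv⟩ ∈ Submodule.span K (Set.range f) := by rw [hf, hs]; trivial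
  have h2 : Set.range f = q '' Set.range fun i => (⟨⁅x i, y i⁆, hxy i⟩ : lieGamma K L (n + 1)) := by
    rw [← Set.range_comp]
    congr 1
    funext i
    exact hfxy i
  rw [h2, ← Submodule.map_span] at h1
  obtain ⟨w, hw, hwv⟩ := h1
  have h3 : (v - w : L) ∈ lieGamma K L (n + 2) := by
    have : (⟨v, hv⟩ : lieGamma K L (n + 1)) - w ∈
      (lieGamma K L (n + 2)).submoduleOf (lieGamma K L (n + 1)) := by
      rw [← Submodule.Quotient.mk_eq_zero, Submodule.Quotient.mk_sub, sub_eq_zero]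
      exact hwv.symm
    exact this
  have h4 : (w : L) ∈ Submodule.span K (Set.range fun i : Fin (Module.finrank K
      (LieGammaFactor K L (n + 1))) => ⁅x (Fin.cast hcard i), y (Fin.cast hcard i)⁆) := by
    have := Submodule.mem_map_of_mem (f := (lieGamma K L (n + 1)).subtype) hw
    rw [Submodule.map_span, ← Set.range_comp] at this
    refine Submodule.span_mono ?_ this
    rintro _ ⟨i, rfl⟩
    exact ⟨Fin.cast hcard.symm i, rfl⟩
  rw [← add_sub_cancel (w : L) v]
  exact Submodule.add_mem_sup h4 h3

theorem finrank_lieGamma_eq (n : ℕ) [FiniteDimensional K (lieGamma K L n)] :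
    Module.finrank K (lieGamma K L n) =
      Module.finrank K (LieGammaFactor K L n) + Module.finrank K (lieGamma K L (n + 1)) := by
  rw [← Submodule.finrank_quotient_add_finrank
    ((lieGamma K L (n + 1)).submoduleOf (lieGamma K L n)),
    (Submodule.submoduleOfEquivOfLe (lieGamma_antitone n.le_succ)).finrank_eq]

theorem finrank_lieGammaFactor_eq_zero {k n : ℕ} (hk : lieGamma K L k = ⊥) (hn : k ≤ n) :
    Module.finrank K (LieGammaFactor K L n) = 0 := by
  have h : lieGamma K L n = ⊥ := eq_bot_iff.2 (hk ▸ lieGamma_antitone hn)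
  have : Subsingleton (lieGamma K L n) := by rw [h]; infer_instance
  exact Module.finrank_zero_of_subsingleton

/-- A basis of `[L, L]` that is adapted to the lower central series of a nilpotent Lie algebra `L`
and consists of commutators. -/
theorem exists_adapted_basis {k : ℕ} (hk : lieGamma K L k = ⊥)
    (hfin : ∀ n, Module.Finite K (LieGammaFactor K L (n + 1))) :
    ∃ e : (Σ n : Fin k, Fin (Module.finrank K (LieGammaFactor K L (n + 1)))) → L,
      LinearIndependent K e ∧
      (∀ s, ∃ x ∈ lieGamma K L s.1, ∃ y, e s = ⁅x, y⁆) ∧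
      ∀ n ≥ 1, lieGamma K L n ≤ Submodule.span K (e '' {s | n ≤ (s.1 : ℕ) + 1}) := by
  choose b hb hbspan using fun n => exists_lie_basis_lieGammaFactor (K := K) (L := L) n
  -- Descending induction on `n`, with `j` bounding the distance to the vanishing term.
  have hspan : ∀ j n, k ≤ n + j → 1 ≤ n → lieGamma K L n ≤ Submodule.span K
      ((fun s : (Σ n : Fin k, Fin (Module.finrank K (LieGammaFactor K L (n + 1)))) =>
        b s.1 s.2) '' {s | n ≤ (s.1 : ℕ) + 1}) := by
    have hbot : ∀ n, k ≤ n → lieGamma K L n ≤ ⊥ := fun n hn => hk ▸ lieGamma_antitone hn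
    intro j
    induction j with
    | zero => exact fun n hn _ => (hbot n hn).trans bot_le
    | succ j ih =>
      intro n hn h1
      rcases le_or_gt k n with hkn | hkn
      · exact (hbot n hkn).trans bot_le
      obtain ⟨n, rfl⟩ := Nat.exists_eq_add_of_le' h1
      refine (hbspan n).trans (sup_le (Submodule.span_mono ?_) ((ih (n + 2) (by omega)
        (by omega)).trans (Submodule.span_mono (Set.image_mono fun s hs => ?_))))
      · rintro _ ⟨i, rfl⟩
        exact ⟨⟨⟨n, by omega⟩, i⟩, le_refl (n + 1), rfl⟩
      · exact (Nat.le_succ _).trans hs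
  refine ⟨fun s => b s.1 s.2, ?_, fun s => hb s.1 s.2, fun n hn => hspan k n (by omega) hn⟩
  have hfd : ∀ n, FiniteDimensional K (lieGamma K L (n + 1)) := fun n => by
    have := FiniteDimensional.span_of_finite K (Set.toFinite
      ((fun s : (Σ n : Fin k, Fin (Module.finrank K (LieGammaFactor K L (n + 1)))) =>
        b s.1 s.2) '' {s | n + 1 ≤ (s.1 : ℕ) + 1}))
    exact Submodule.finiteDimensional_of_le (hspan k (n + 1) (by omega) (by omega))
  -- Independence follows by counting: the family spans at least [L, L], whose dimension telescopes
  -- to the number of vectors.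
  rw [linearIndependent_iff_card_le_finrank_span]
  have h1 : lieGamma K L 1 ≤ Submodule.span K (Set.range
      (fun s : (Σ n : Fin k, Fin (Module.finrank K (LieGammaFactor K L (n + 1)))) =>
        b s.1 s.2)) :=
    (hspan k 1 (by omega) le_rfl).trans (Submodule.span_mono (Set.image_subset_range _ _))
  have h2 : ∀ j, Module.finrank K (lieGamma K L 1) = ∑ n ∈ Finset.range j,
      Module.finrank K (LieGammaFactor K L (n + 1)) +
        Module.finrank K (lieGamma K L (j + 1)) := by
    intro j
    induction j with
    | zero => simp
    | succ j ih =>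
      rw [ih, finrank_lieGamma_eq (j + 1), Finset.sum_range_succ]
      exact (add_assoc _ _ _).symm
  have h3 : Module.finrank K (lieGamma K L (k + 1)) = 0 := by
    have : lieGamma K L (k + 1) = ⊥ := eq_bot_iff.2 (hk ▸ lieGamma_antitone k.le_succ)
    rw [this, finrank_bot]
  have h4 := h2 k
  rw [h3, add_zero, ← Fin.sum_univ_eq_sum_range
    (fun n => Module.finrank K (LieGammaFactor K L (n + 1)))] at h4
  simp only [Fintype.card_sigma, Fintype.card_fin]
  rw [← h4]
  have := FiniteDimensional.span_of_finite K (Set.finite_range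
      (fun s : (Σ n : Fin k, Fin (Module.finrank K (LieGammaFactor K L (n + 1)))) =>
        b s.1 s.2))
  exact Submodule.finrank_mono h1

theorem finsum_mul_finrank_lieGammaFactor {k : ℕ} (hk : lieGamma K L k = ⊥) :
    ∑ᶠ (n : ℕ) (_ : 1 ≤ n), n * Module.finrank K (LieGammaFactor K L n) =
      ∑ s : (Σ n : Fin k, Fin (Module.finrank K (LieGammaFactor K L (n + 1)))),
        ((s.1 : ℕ) + 1) := by
  rw [finsum_eq_sum_of_support_subset (s := Finset.range (k + 1))]
  · rw [Finset.sum_range_succ', Fintype.sum_sigma]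
    simp only [Nat.le_add_left, finsum_true, Finset.sum_const, Finset.card_univ, Fintype.card_fin,
      smul_eq_mul]
    rw [← Fin.sum_univ_eq_sum_range
      (fun n => (n + 1) * Module.finrank K (LieGammaFactor K L (n + 1)))]
    simp [mul_comm]
  · intro n hn
    rw [Finset.coe_range, Set.mem_Iio]
    by_contra! h
    apply hn
    simp [finrank_lieGammaFactor_eq_zero hk (show k ≤ n by omega)]

/-- A basis of `[L, L]` that is adapted to the lower central series, with its weights. -/
theorem exists_weighted_basis {k : ℕ} (hk : lieGamma K L k = ⊥)
    (hfin : ∀ n, Module.Finite K (LieGammaFactor K L (n + 1))) :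
    ∃ (σ : Type) (_ : Fintype σ) (e : σ → L) (wt : σ → ℕ), LinearIndependent K e ∧
      (∀ s, ∃ n, wt s = n + 1 ∧ ∃ x ∈ lieGamma K L n, ∃ y, e s = ⁅x, y⁆) ∧
      (∀ n ≥ 1, lieGamma K L n ≤ Submodule.span K (e '' {s | n ≤ wt s})) ∧
      ∑ᶠ (n : ℕ) (_ : 1 ≤ n), n * Module.finrank K (LieGammaFactor K L n) = ∑ s, wt s := by
  obtain ⟨e, hli, he, hspan⟩ := exists_adapted_basis hk hfin
  exact ⟨_, inferInstance, e, fun s => s.1 + 1, hli, fun s => ⟨s.1, rfl, he s⟩, hspan,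
    finsum_mul_finrank_lieGammaFactor hk⟩

end AdaptedBasis

/-! ### Assembly -/

theorem mainTheorem2 {K L : Type*} [Field K] [LieRing L] [LieAlgebra K L]
    (p : ℕ) [Fact p.Prime] [CharP K p] :
    ((∀ n, poissonDimension K L n = lieGamma K L n) ∧
      (∀ n, truncatedPoissonDimension K L p n = lieGamma K L n)) ∧
    (PoissonAlgebra.IsLieNilpotent K (TruncatedSymmetricAlgebra K L p) →
      (∀ n ≥ 1, Module.Finite K (LieGammaFactor K L n)) ∧
      {n : ℕ | Module.finrank K (LieGammaFactor K L n) ≠ 0 ∧ 1 ≤ n}.Finite ∧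
      PoissonAlgebra.IsStronglyLieNilpotentOfClass K (TruncatedSymmetricAlgebra K L p)
        (1 + (p - 1) * ∑ᶠ (n : ℕ) (_ : 1 ≤ n), n * Module.finrank K (LieGammaFactor K L n)) ∧
      (3 < p →
        PoissonAlgebra.IsLieNilpotentOfClass K (TruncatedSymmetricAlgebra K L p)
          (1 + (p - 1) * ∑ᶠ (n : ℕ) (_ : 1 ≤ n), n * Module.finrank K (LieGammaFactor K L n)))) := by
  have hp : 2 ≤ p := (Fact.out : p.Prime).two_le
  have h1 := lieGamma_le_poissonDimension (K := K) (L := L)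
  have h2 := poissonDimension_le_truncatedPoissonDimension (K := K) (L := L) p
  have h3 := truncatedPoissonDimension_le_lieGamma (K := K) (L := L) hp
  refine ⟨⟨fun n => ((h2 n).trans (h3 n)).antisymm (h1 n),
    fun n => (h3 n).antisymm ((h1 n).trans (h2 n))⟩, ?_⟩
  rintro ⟨k, hk⟩
  have hfin := TruncatedSymmetricAlgebra.finite_lieGammaFactor_of_gamma_eq_bot hk
  have hLk : lieGamma K L k = ⊥ := by
    refine eq_bot_iff.2 fun x hx => ?_
    have := TruncatedSymmetricAlgebra.ι_mem_gamma (p := p) k hx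
    rw [hk] at this
    exact TruncatedSymmetricAlgebra.eq_zero_of_ι_eq_zero hp this
  obtain ⟨σ, _, e, wt, hli, he, hspan, hsum⟩ := exists_weighted_basis hLk hfin
  have he' : ∀ s, e s ∈ lieGamma K L (wt s) := fun s => by
    obtain ⟨n, hn, x, hx, y, hxy⟩ := he s
    rw [hn, hxy]
    exact lie_mem_lieGamma_succ hx y
  rw [hsum]
  have hbot := TruncatedSymmetricAlgebra.upperPower_eq_bot (p := p) hspan he'
  refine ⟨fun n hn => ?_, (Set.finite_lt_nat k).subset fun n hn => ?_,
    ⟨Nat.le_add_right _ _, hbot, ?_⟩, fun h3 => ⟨Nat.le_add_right _ _, ?_, ?_⟩⟩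
  · obtain ⟨n, rfl⟩ := Nat.exists_eq_add_of_le' hn
    exact hfin n
  · by_contra h
    exact hn.1 (finrank_lieGammaFactor_eq_zero hLk (not_lt.1 h))
  · rw [Nat.add_sub_cancel_left]
    exact TruncatedSymmetricAlgebra.upperPower_ne_bot hli he'
  -- The lower central series lies inside the upper powers, so the upper bound on the strong class
  -- bounds the Lie class as well.
  · refine eq_bot_iff.2 fun a ha => ?_
    have := PoissonAlgebra.gamma_le_upperPower _ ha
    rwa [hbot] at this
  · rw [Nat.add_sub_cancel_left]
    exact TruncatedSymmetricAlgebra.gamma_ne_bot h3 hli he
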